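/- **Setting.** Let $d\ge 1$ and let $\mathbb M\subset\mathbb R^D$ be a compact $d$-dimensional manifold without boundary (with the subspace topology) of positive reach; let $P$ be a probability measure with $P(\mathbb M)=1$. For $x\in\mathbb R^D$, $t>0$ put $\rho(x,t)=P(B(x,t/2))/t^d$ ($B(x,r)$ is the closed Euclidean ball), $\rho(x,\downarrow 0)=\lim_{t\downarrow 0}\rho(x,t)$, $\rho(t)=\inf_{x\in\mathbb M}\rho(x,t)$, $\rho=\lim_{t\downarrow0}\rho(t)$. Assume that $\rho>0$ and that, for some $t_0>0$ and $C_1,C_2<\infty$, the functions $t\mapsto\rho(x,t)$ ($x\in\mathbb M$) and $t\mapsto\rho(t)$, extended to $t=0$ by these limits, are differentiable on $[0,t_0)$ (from the right at $0$) with derivatives bounded in absolute value by $C_1$ (for all $x\in\mathbb M$) and $C_2$. Assume that $\rho(X,\downarrow 0)$, $X\sim P$, has a Lebesgue density $g$. Let $K:\mathbb R\to\mathbb R$ be a symmetric Lipschitz kernel with $\int K=1$ and $\int u^2|K(u)|\,du<\infty$. Let $r_n=(\log n/n)^{1/(d+2)}$. For a sample $X_1,\dots,X_n$ with empirical measure $P_n$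 put $\hat\rho(x,t)=P_n(B(x,t/2))/t^d$, $V_i=\hat\rho(X_i,r_n)$, $\hat\rho_n=\min_i V_i$, and, for a bandwidth $b>0$, $$\hat g(v)=\frac1n\sum_{i=1}^n\frac1b K\Big(\frac{v-V_i}{b}\Big).$$ **(1)** Let $X_1,X_2,\dots$ be i.i.d. from $P$ and let $g$ be differentiable on $\mathbb R$ with Lipschitz derivative. Then $$\sup_{v\in\mathbb R}|\hat g(v)-g(v)|\le C b^2+O_P\Big(\sqrt{\tfrac{\log n}{nb}}\Big)+O\Big(\frac{r_n}{b^2}\Big),$$ uniformly in $b>0$. That is, there are constants $C,C'$ such that for each $\varepsilon>0$ there are $A$ and $N$ such that, for all $n\ge N$ and all $b>0$, the bound $\sup_v|\hat g(v)-g(v)|\le Cb^2+A\sqrt{\log n/(nb)}+C'r_n/b^2$ holds with probability at least $1-\varepsilon$. Hence, if $b=b_n\asymp r_n^{1/4}$, then $\sup_v|\hat g(v)-g(v)|=O_P(r_n^{1/2})$. **(2)** Suppose in addition that $K\ge0$ (no smoothness of $g$ is needed here). Let $\alpha\in(0,1)$, $b_n>0$ and $b_n\to0$. An i.i.d. sample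 of size $2n$ from $P$ is split at random into two halves $\mathcal S_{1,n},\mathcal S_{2,n}$ of size $n$. Let $\hat g$ (with bandwidth $b_n$) and $\hat\rho_n$ be computed from $\mathcal S_{1,n}$, let $\ell=\hat\rho_n$ or $\ell=\rho$, and let $\hat t>0$ be the solution of $$\frac{2^{d+1}}{\hat t^{\,d}}\int_{\ell}^\infty\frac{\hat g(v)}{v}\,e^{-nv\hat t^{\,d}/2}\,dv=\alpha .$$ If $\ell=\hat\rho_n$, this solution exists and is unique for every $n\ge2$ and every sample; if $\ell=\rho$, it exists and is unique with probability tending to $1$ (put $\hat t=0$ where there is none). In both cases, with $\mathbf H$ the Hausdorff distance, $$\mathbb P\big(\mathbf H(\mathcal S_{2,n},\mathbb M)>\hat t\,\big)\le\alpha+O(r_n)\qquad(n\to\infty).$$ -/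

import Mathlib

open MeasureTheory Filter Topology Asymptotics Set
open scoped ENNReal NNReal

noncomputable section

/-- The ambient Euclidean space `ℝ^D`. -/
abbrev Ambient (D : ℕ) : Type := EuclideanSpace ℝ (Fin D)

/-- The reach of `M`: the supremum of all `r` such that every point at distance less than `r`
from `M` has a unique nearest point in `M`. -/
def reach {D : ℕ} (M : Set (Ambient D)) : ℝ≥0∞ :=
  sSup {r : ℝ≥0∞ | ∀ y : Ambient D, Metric.infEDist y M < r →
    ∃! x : Ambient D, x ∈ M ∧ edist y x = Metric.infEDist y M}

/-- `M ⊆ ℝ^D` is (with the subspace topology) a compact `d`-dimensional manifold without boundary,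
it has positive reach, and the probability measure `P` lives on `M`. No smoothness of the charts is
required, so that every compact smoothly embedded submanifold is included. -/
structure ManifoldModel {D : ℕ} (d : ℕ) (M : Set (Ambient D)) (P : Measure (Ambient D)) :
    Prop where
  compact : IsCompact M
  manifold : Nonempty (ChartedSpace (EuclideanSpace ℝ (Fin d)) M)
  reach_pos : 0 < reach M
  prob : IsProbabilityMeasure P
  supported : P Mᶜ = 0

/-- The function `f` on `(0, ∞)`, extended to `0` by its right limit `f(↓0)`. -/
def extendZero (f : ℝ → ℝ) (t : ℝ) : ℝ :=
  if t = 0 then limUnder (𝓝[>] (0 : ℝ)) f else f t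

/-- `ρ(x, t) = P(B(x, t/2)) / t^d` for `t > 0`, and `ρ(x, 0) = ρ(x, ↓0)` is its right limit. -/
def rho {D : ℕ} (d : ℕ) (P : Measure (Ambient D)) (x : Ambient D) : ℝ → ℝ :=
  extendZero fun t => P.real (Metric.closedBall x (t / 2)) / t ^ d

/-- The local density `ρ(x, ↓0)`. -/
def localDensity {D : ℕ} (d : ℕ) (P : Measure (Ambient D)) (x : Ambient D) : ℝ :=
  rho d P x 0

/-- `ρ(t) = inf_{x ∈ M} ρ(x, t)` for `t > 0`, and `ρ(0)` is its right limit. -/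
def rhoInf {D : ℕ} (d : ℕ) (M : Set (Ambient D)) (P : Measure (Ambient D)) : ℝ → ℝ :=
  extendZero fun t => ⨅ x : M, rho d P x t

/-- The constant `ρ = lim_{t ↓ 0} ρ(t)`. -/
def rhoMin {D : ℕ} (d : ℕ) (M : Set (Ambient D)) (P : Measure (Ambient D)) : ℝ :=
  rhoInf d M P 0

/-- The regularity assumption on `P`: the functions `t ↦ ρ(x, t)`, `x ∈ M`, and `t ↦ ρ(t)` are
differentiable on `[0, t₀)` (from the right at `0`, which includes the existence of the right
limits at `0`), their derivatives are bounded by `C₁` (for all `x ∈ M`) and `C₂`, and `ρ > 0`. -/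
def RegularDensity {D : ℕ} (d : ℕ) (M : Set (Ambient D)) (P : Measure (Ambient D)) : Prop :=
  0 < rhoMin d M P ∧ ∃ t₀ > (0 : ℝ), ∃ C₁ C₂ : ℝ,
    (∀ x ∈ M, DifferentiableOn ℝ (rho d P x) (Ico 0 t₀) ∧
      ∀ t ∈ Ico 0 t₀, |derivWithin (rho d P x) (Ico 0 t₀) t| ≤ C₁) ∧
    DifferentiableOn ℝ (rhoInf d M P) (Ico 0 t₀) ∧
      ∀ t ∈ Ico 0 t₀, |derivWithin (rhoInf d M P) (Ico 0 t₀) t| ≤ C₂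

/-- `g` is a Lebesgue density of `ρ(X, ↓0)`, where `X` has law `P`. -/
structure IsShellDensity {D : ℕ} (d : ℕ) (P : Measure (Ambient D)) (g : ℝ → ℝ) : Prop where
  measurable : Measurable g
  nonneg : ∀ v, 0 ≤ g v
  law : P.map (localDensity d P) = volume.withDensity fun v => ENNReal.ofReal (g v)

/-- A Lipschitz symmetric kernel on `ℝ` with integral one and a finite second moment. -/
structure IsSmoothingKernel (K : ℝ → ℝ) : Prop where
  symmetric : ∀ u, K (-u) = K u
  integrable : Integrable K
  integral_eq_one : ∫ u, K u = 1
  second_moment : Integrable fun u => u ^ 2 * K u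
  lipschitz : ∃ L : ℝ≥0, LipschitzWith L K

/-- `r_n = (log n / n)^{1/(d+2)}`. -/
def rate (d n : ℕ) : ℝ := (Real.log n / n) ^ (1 / ((d : ℝ) + 2))

/-- `ρ̂(y, t) = P_n(B(y, t/2)) / t^d`, with `P_n` the empirical measure of the sample `x`. -/
def rhoHat {D n : ℕ} (d : ℕ) (x : Fin n → Ambient D) (y : Ambient D) (t : ℝ) : ℝ :=
  ((Nat.card {j : Fin n // x j ∈ Metric.closedBall y (t / 2)} : ℝ) / n) / t ^ d

/-- The estimated values `V_i = ρ̂(X_i, r_n)`. -/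
def shellValue {D n : ℕ} (d : ℕ) (x : Fin n → Ambient D) (i : Fin n) : ℝ :=
  rhoHat d x (x i) (rate d n)

/-- `ρ̂_n = min_i ρ̂(X_i, r_n)`. -/
def rhoHatMin {D n : ℕ} (d : ℕ) (x : Fin n → Ambient D) : ℝ :=
  ⨅ i, shellValue d x i

/-- The kernel estimator `ĝ(v) = n⁻¹ ∑ᵢ b⁻¹ K((v - V_i) / b)`. -/
def gHat {D n : ℕ} (d : ℕ) (K : ℝ → ℝ) (b : ℝ) (x : Fin n → Ambient D) (v : ℝ) : ℝ :=
  (1 / (n : ℝ)) * ∑ i, (1 / b) * K ((v - shellValue d x i) / b)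

/-- The estimated shells bound
`(2^{d+1} / t^d) ∫_ℓ^∞ (ĝ(v) / v) exp(-n v t^d / 2) dv` with lower endpoint `ℓ`. -/
def shellBound {D n : ℕ} (d : ℕ) (K : ℝ → ℝ) (b l : ℝ) (x : Fin n → Ambient D) (t : ℝ) : ℝ :=
  (2 ^ (d + 1) / t ^ d) *
    ∫ v in Ioi l, gHat d K b x v / v * Real.exp (-((n : ℝ) * v * t ^ d / 2))

/-- `t` is a positive solution of the equation "estimated shells bound at `t` equals `α`". -/
def SolvesShell {D n : ℕ} (d : ℕ) (K : ℝ → ℝ) (α b l : ℝ) (x : Fin n → Ambient D) (t : ℝ) :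
    Prop :=
  0 < t ∧ shellBound d K b l x t = α

/-- The radius `t̂`: the solution of the equation `SolvesShell` where this is unique
(the value is `0` if there is no solution). -/
def tHat {D n : ℕ} (d : ℕ) (K : ℝ → ℝ) (α b l : ℝ) (x : Fin n → Ambient D) : ℝ :=
  sInf {t | SolvesShell d K α b l x t}

/-- The law of an i.i.d. sample of size `n` from `P`. -/
def sampleLaw {D : ℕ} (P : Measure (Ambient D)) (n : ℕ) : Measure (Fin n → Ambient D) :=
  Measure.pi fun _ => P

instance permMeasurableSpace (n : ℕ) : MeasurableSpace (Equiv.Perm (Fin n ⊕ Fin n)) := ⊤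

/-- The law of an i.i.d. sample of size `2n` from `P` (indexed by `Fin n ⊕ Fin n`) together with an
independent uniformly distributed permutation of the indices. -/
def splitLaw {D : ℕ} (P : Measure (Ambient D)) (n : ℕ) :
    Measure ((Fin n ⊕ Fin n → Ambient D) × Equiv.Perm (Fin n ⊕ Fin n)) :=
  (Measure.pi fun _ => P).prod (PMF.uniformOfFintype (Equiv.Perm (Fin n ⊕ Fin n))).toMeasure

/-- The first random half `S_{1,n}` of the data. -/
def firstHalf {D n : ℕ} (ω : (Fin n ⊕ Fin n → Ambient D) × Equiv.Perm (Fin n ⊕ Fin n)) :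
    Fin n → Ambient D := fun i => ω.1 (ω.2 (Sum.inl i))

/-- The second random half `S_{2,n}` of the data. -/
def secondHalf {D n : ℕ} (ω : (Fin n ⊕ Fin n → Ambient D) × Equiv.Perm (Fin n ⊕ Fin n)) :
    Fin n → Ambient D := fun i => ω.1 (ω.2 (Sum.inr i))

end

/-! Write q for the local density and r for `rate d n`. The derivative bounds enter through one
estimate: P(B(x, t/2)) = q(x) t^d + O(t^(d+1)) uniformly on `M`, with ρ = inf q > 0. This is
`UniformDensity`. From it q is bounded and continuous on `M`, and Bernstein's inequality,
conditionally on each X_i, gives max |V_i - q(X_i)| = O(r) outside an event of probability O(n^(-2))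
(`real_shellValue_sub_le`); the rate reflects n r^(d+2) = log n.

Part (1) splits ĝ - g into three terms. Replacing V_i by q(X_i) costs O(r / b^2), because K is
Lipschitz. The centred kernel average of the q(X_i) is controlled by Bernstein's inequality at fixed
v and a union bound over a polynomial grid (`real_not_abs_kernelDeviation_le`); the decay of K
disposes of large v. The remaining bias is O(b^2), by a Taylor expansion whose linear term cancels
by symmetry of K. When b ≥ 1 or b ≤ r the claimed bound is larger than a trivial bound for |ĝ - g|.

Part (2) rests on a gap of constants. A ball of diameter t has mass about v t^d at local density v,
while the shells equation contains exp(-n v t^d / 2), with half that exponent. Take the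
deterministic t_n with t_n^d = (4 / (3ρ)) log n / n. A covering argument shows that the Hausdorff
distance exceeds t_n with probability O(1 / log n) (`tendsto_real_lt_hausdorffDist`). On the other
hand ĝ puts mass bounded below on values up to 5ρ/4, so the shells bound at t_n is at least of order
(n / log n) n^(-5/6), which diverges and thus exceeds α. The bound decreases in t, hence t̂ ≥ t_n
with probability tending to one (`exists_bad_event`). The failure probability therefore tends to 0,
and is eventually at most α. -/

/-! ### Small-scale mass of balls and the local density -/

/-- The uniform small-scale behaviour of a measure `P` on `M` whose local density `localDensity d P`
takes values in `[ρ, R]` and has infimum `ρ`. -/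
structure UniformDensity {D : ℕ} (d : ℕ) (M : Set (Ambient D)) (P : Measure (Ambient D))
    (ρ t₁ C R : ℝ) : Prop where
  rho_pos : 0 < ρ
  scale_pos : 0 < t₁
  const_nonneg : 0 ≤ C
  const_mul_le : C * t₁ ≤ ρ / 4
  approx : ∀ x ∈ M, ∀ t ∈ Ioc 0 t₁,
    |P.real (Metric.closedBall x (t / 2)) - localDensity d P x * t ^ d| ≤ C * t ^ (d + 1)
  le_upper : ∀ x ∈ M, localDensity d P x ≤ R
  lower_le : ∀ x ∈ M, ρ ≤ localDensity d P x
  exists_lt : ∀ ε > 0, ∃ x ∈ M, localDensity d P x < ρ + ε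

theorem extendZero_of_ne_zero {f : ℝ → ℝ} {t : ℝ} (ht : t ≠ 0) : extendZero f t = f t :=
  if_neg ht

theorem rho_of_pos {D d : ℕ} {P : Measure (Ambient D)} {x : Ambient D} {t : ℝ} (ht : 0 < t) :
    rho d P x t = P.real (Metric.closedBall x (t / 2)) / t ^ d :=
  extendZero_of_ne_zero ht.ne'

/-- Differentiability at 0 includes continuity there, so for an `extendZero` function the value at 0
is a genuine right limit and not a default value of `limUnder`. -/
theorem tendsto_nhdsGT_of_differentiableOn_Ico {f : ℝ → ℝ} {t₀ : ℝ} (ht₀ : 0 < t₀)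
    (hf : DifferentiableOn ℝ f (Ico 0 t₀)) : Tendsto f (𝓝[>] 0) (𝓝 (f 0)) := by
  have h := (hf 0 ⟨le_rfl, ht₀⟩).continuousWithinAt
  have h2 : ContinuousWithinAt f (Ioo 0 t₀) 0 := h.mono Ioo_subset_Ico_self
  rwa [ContinuousWithinAt, nhdsWithin_Ioo_eq_nhdsGT ht₀] at h2

/-- The mean value inequality on [0, t] turns the derivative bound into |ρ(x, t) - q(x)| ≤ C t with
the same C for all x in `M`; every field follows from this and from ρ(t) → ρ. -/
theorem RegularDensity.uniformDensity {D d : ℕ} {M : Set (Ambient D)} {P : Measure (Ambient D)}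
    [IsProbabilityMeasure P] (hMne : M.Nonempty) (hP : RegularDensity d M P) :
    ∃ t₁ C R : ℝ, UniformDensity d M P (rhoMin d M P) t₁ C R := by
  obtain ⟨hpos, t₀, ht₀, C₁, C₂, hx, hinf, -⟩ := hP
  set C := |C₁| + 1 with hC
  have hC0 : 0 < C := by positivity
  set ρ := rhoMin d M P with hρ
  have hlip : ∀ x ∈ M, ∀ t ∈ Ico 0 t₀, |rho d P x t - localDensity d P x| ≤ C * t := by
    intro x hxM t ht
    have h := (convex_Ico (0 : ℝ) t₀).norm_image_sub_le_of_norm_derivWithin_le (C := C)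
      (hx x hxM).1 (fun s hs => by
        have := (hx x hxM).2 s hs
        have h2 := le_abs_self C₁
        rw [Real.norm_eq_abs]; linarith) (x := 0) (y := t) ⟨le_rfl, ht₀⟩ ht
    simpa [Real.norm_eq_abs, abs_of_nonneg ht.1, localDensity] using h
  have hnn : ∀ x t, 0 < t → 0 ≤ rho d P x t := by
    intro x t ht
    rw [rho_of_pos ht]; positivity
  have hbdd : ∀ t, 0 < t → BddBelow (range fun x : M => rho d P x t) := by
    rintro t ht
    exact ⟨0, by rintro _ ⟨x, rfl⟩; exact hnn _ _ ht⟩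
  have hinf_eq : ∀ t, 0 < t → rhoInf d M P t = ⨅ x : M, rho d P x t := fun t ht =>
    extendZero_of_ne_zero ht.ne'
  have hlow : ∀ x ∈ M, ρ ≤ localDensity d P x := by
    intro x hxM
    refine le_of_tendsto_of_tendsto (tendsto_nhdsGT_of_differentiableOn_Ico ht₀ hinf)
      (tendsto_nhdsGT_of_differentiableOn_Ico ht₀ (hx x hxM).1) ?_
    filter_upwards [self_mem_nhdsWithin] with t ht
    rw [hinf_eq t ht]
    exact ciInf_le (hbdd t ht) (⟨x, hxM⟩ : M)
  have : Nonempty M := hMne.to_subtype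
  -- The first entry keeps t₁ strictly below t₀; the second gives C t₁ ≤ ρ/4, so that balls have
  -- mass at least (3/4) ρ t^d. The upper bound R below comes from P(B) ≤ 1 at scale t₁.
  set t₁ := min (t₀ / 2) (ρ / (4 * C)) with ht₁
  have ht₁pos : 0 < t₁ := lt_min (by positivity) (by positivity)
  have ht₁lt : t₁ < t₀ := (min_le_left _ _).trans_lt (by linarith)
  refine ⟨t₁, C, 1 / t₁ ^ d + C * t₁, hpos, ht₁pos, hC0.le, ?_, ?_, ?_, hlow, ?_⟩
  · calc C * t₁ ≤ C * (ρ / (4 * C)) := by gcongr; exact min_le_right _ _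
      _ = ρ / 4 := by field_simp
  · intro x hxM t ht
    have h := hlip x hxM t ⟨ht.1.le, ht.2.trans_lt ht₁lt⟩
    rw [rho_of_pos ht.1] at h
    have htd : 0 < t ^ d := pow_pos ht.1 d
    have : P.real (Metric.closedBall x (t / 2)) - localDensity d P x * t ^ d =
        (P.real (Metric.closedBall x (t / 2)) / t ^ d - localDensity d P x) * t ^ d := by
      field_simp
    rw [this, abs_mul, abs_of_pos htd, pow_succ', ← mul_assoc]
    gcongr
  · intro x hxM
    have h := (abs_le.1 (hlip x hxM t₁ ⟨ht₁pos.le, ht₁lt⟩)).1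
    rw [rho_of_pos ht₁pos] at h
    have : P.real (Metric.closedBall x (t₁ / 2)) / t₁ ^ d ≤ 1 / t₁ ^ d := by
      gcongr; exact measureReal_le_one
    linarith
  -- A near-minimiser of ρ(·, t) at one small t is a near-minimiser of q, by the uniform Lipschitz
  -- bound.
  · intro ε hε
    have h1 : ∀ᶠ t in 𝓝[>] (0 : ℝ), rhoInf d M P t < ρ + ε / 3 :=
      (tendsto_nhdsGT_of_differentiableOn_Ico ht₀ hinf).eventually_lt_const
        (by change ρ < _; linarith)
    have h2 : ∀ᶠ t in 𝓝[>] (0 : ℝ), t < min t₀ (ε / (3 * C)) :=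
      nhdsWithin_le_nhds (eventually_lt_nhds (lt_min ht₀ (by positivity)))
    obtain ⟨t, ⟨h1, h2⟩, h3⟩ := ((h1.and h2).and self_mem_nhdsWithin).exists
    have h3 : 0 < t := h3
    rw [hinf_eq t h3] at h1
    obtain ⟨x, hx1⟩ := exists_lt_of_ciInf_lt h1
    refine ⟨x, x.2, ?_⟩
    have h4 := (abs_le.1 (hlip x x.2 t ⟨h3.le, h2.trans_le (min_le_left _ _)⟩)).1
    have h5 : C * t ≤ ε / 3 := by
      calc C * t ≤ C * (ε / (3 * C)) := by gcongr; exact (h2.trans_le (min_le_right _ _)).le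
        _ = ε / 3 := by field_simp
    have hx1 : rho d P x t < ρ + ε / 3 := hx1
    by_contra! h6
    linarith

namespace UniformDensity

variable {D d : ℕ} {M : Set (Ambient D)} {P : Measure (Ambient D)} {ρ t₁ C R : ℝ}

theorem rho_le (h : UniformDensity d M P ρ t₁ C R) : ρ ≤ R := by
  obtain ⟨x, hx, -⟩ := h.exists_lt 1 one_pos
  exact (h.lower_le x hx).trans (h.le_upper x hx)

theorem measureReal_ball_le (h : UniformDensity d M P ρ t₁ C R) {x : Ambient D} (hx : x ∈ M) {t : ℝ}
    (ht : t ∈ Ioc 0 t₁) : P.real (Metric.closedBall x (t / 2)) ≤ 2 * R * t ^ d := by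
  have h1 := (abs_le.1 (h.approx x hx t ht)).2
  have h2 : C * t ^ (d + 1) ≤ ρ / 4 * t ^ d := by
    rw [pow_succ', ← mul_assoc]
    have := pow_pos ht.1 d
    have h3 := h.const_mul_le
    have h4 : C * t ≤ C * t₁ := mul_le_mul_of_nonneg_left ht.2 h.const_nonneg
    gcongr; linarith
  have h5 := mul_le_mul_of_nonneg_right (h.le_upper x hx) (pow_pos ht.1 d).le
  have h6 := mul_le_mul_of_nonneg_right h.rho_le (pow_pos ht.1 d).le
  have h7 := mul_pos h.rho_pos (pow_pos ht.1 d)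
  linarith

theorem le_measureReal_ball (h : UniformDensity d M P ρ t₁ C R) {x : Ambient D} (hx : x ∈ M) {t : ℝ}
    (ht : t ∈ Ioc 0 t₁) : 3 / 4 * ρ * t ^ d ≤ P.real (Metric.closedBall x (t / 2)) := by
  have h1 := (abs_le.1 (h.approx x hx t ht)).1
  have h2 : C * t ^ (d + 1) ≤ ρ / 4 * t ^ d := by
    rw [pow_succ', ← mul_assoc]
    have := pow_pos ht.1 d
    have h3 := h.const_mul_le
    have h4 : C * t ≤ C * t₁ := mul_le_mul_of_nonneg_left ht.2 h.const_nonneg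
    gcongr; linarith
  have h5 := mul_le_mul_of_nonneg_right (h.lower_le x hx) (pow_pos ht.1 d).le
  linarith

/-- The local density is uniformly continuous on `M`. -/
theorem exists_localDensity_le_add [IsFiniteMeasure P] (h : UniformDensity d M P ρ t₁ C R) {ε : ℝ}
    (hε : 0 < ε) : ∃ δ > 0, ∀ x ∈ M, ∀ y ∈ M, dist x y ≤ δ →
      localDensity d P y ≤ localDensity d P x + ε := by
  -- If dist x y ≤ t²/2 then B(y, t/2) lies in B(x, (t + t²)/2). Comparing masses and dividing by
  -- t^d bounds q(y) - q(x) by this function of t, which vanishes at 0.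
  have hcont : Continuous fun t : ℝ =>
      R * ((1 + t) ^ d - 1) + C * (t + t ^ 2) * (1 + t) ^ d + C * t := by fun_prop
  have h1 := (hcont.tendsto 0).eventually_lt_const (show _ < ε by simpa using hε)
  have h2 : ∀ᶠ t in 𝓝[>] (0 : ℝ), t < min 1 (t₁ / 2) :=
    nhdsWithin_le_nhds (eventually_lt_nhds (lt_min one_pos (half_pos h.scale_pos)))
  obtain ⟨t, ⟨h1, h2⟩, h3⟩ := 
    (((h1.filter_mono nhdsWithin_le_nhds).and h2).and self_mem_nhdsWithin).exists
  have ht : 0 < t := h3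
  have htt : t < 1 := h2.trans_le (min_le_left _ _)
  have ht1 : t < t₁ / 2 := h2.trans_le (min_le_right _ _)
  have hs : t + t ^ 2 ≤ t₁ := by nlinarith
  have hs0 : 0 < t + t ^ 2 := by positivity
  refine ⟨t ^ 2 / 2, by positivity, fun x hx y hy hxy => ?_⟩
  have hsub : Metric.closedBall y (t / 2) ⊆ Metric.closedBall x ((t + t ^ 2) / 2) := by
    refine Metric.closedBall_subset_closedBall' ?_
    rw [dist_comm]; linarith
  have hle := measureReal_mono hsub (measure_ne_top P _)
  have hy' := (abs_le.1 (h.approx y hy t ⟨ht, by linarith [h.scale_pos]⟩)).1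
  have hx' := (abs_le.1 (h.approx x hx (t + t ^ 2) ⟨hs0, hs⟩)).2
  have htd : 0 < t ^ d := pow_pos ht d
  have e : (t + t ^ 2) ^ d = t ^ d * (1 + t) ^ d := by rw [← mul_pow]; ring
  have key : localDensity d P y * t ^ d ≤
      (localDensity d P x * (1 + t) ^ d + C * (t + t ^ 2) * (1 + t) ^ d + C * t) * t ^ d := by
    have e1 : C * t ^ (d + 1) = C * t * t ^ d := by ring
    have e2 : C * (t + t ^ 2) ^ (d + 1) = C * (t + t ^ 2) * (1 + t) ^ d * t ^ d := by
      rw [pow_succ, e]; ring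
    have e3 : localDensity d P x * (t + t ^ 2) ^ d = localDensity d P x * (1 + t) ^ d * t ^ d := by
      rw [e]; ring
    nlinarith
  have key := le_of_mul_le_mul_right key htd
  have h5 : localDensity d P x * ((1 + t) ^ d - 1) ≤ R * ((1 + t) ^ d - 1) :=
    mul_le_mul_of_nonneg_right (h.le_upper x hx) (by
      have := one_le_pow₀ (n := d) (show 1 ≤ 1 + t by linarith); linarith)
  linarith

theorem continuousOn_localDensity [IsFiniteMeasure P] (h : UniformDensity d M P ρ t₁ C R) :
    ContinuousOn (localDensity d P) M := by
  rw [Metric.continuousOn_iff]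
  intro x hx ε hε
  obtain ⟨δ, hδ, H⟩ := h.exists_localDensity_le_add (half_pos hε)
  refine ⟨δ, hδ, fun y hy hxy => ?_⟩
  have h1 := H x hx y hy (by rw [dist_comm]; exact hxy.le)
  have h2 := H y hy x hx hxy.le
  rw [Real.dist_eq, abs_lt]
  constructor <;> linarith

theorem aemeasurable_localDensity [IsFiniteMeasure P] (h : UniformDensity d M P ρ t₁ C R)
    (hM : MeasurableSet M) (hPM : P Mᶜ = 0) : AEMeasurable (localDensity d P) P := by
  have h1 : AEMeasurable (localDensity d P) (P.restrict M) :=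
    h.continuousOn_localDensity.aemeasurable hM
  rwa [Measure.restrict_eq_self_of_ae_mem (by rw [ae_iff]; exact hPM)] at h1

/-- Values of the local density close to its infimum have positive probability. -/
theorem measureReal_lt_pos [IsFiniteMeasure P] (h : UniformDensity d M P ρ t₁ C R)
    (hPM : P Mᶜ = 0) {ε : ℝ} (hε : 0 < ε) :
    0 < P.real {x | x ∈ M ∧ localDensity d P x < ρ + ε} := by
  obtain ⟨x, hx, hxε⟩ := h.exists_lt (ε / 2) (half_pos hε)
  obtain ⟨δ, hδ, H⟩ := h.exists_localDensity_le_add (show 0 < ε / 2 by positivity)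
  set t := min t₁ δ with ht
  have htpos : 0 < t := lt_min h.scale_pos hδ
  have h1 := h.le_measureReal_ball hx (t := t) ⟨htpos, min_le_left _ _⟩
  have h2 : 0 < 3 / 4 * ρ * t ^ d := by have := h.rho_pos; positivity
  have h3 : P.real (Metric.closedBall x (t / 2)) ≤
      P.real {x | x ∈ M ∧ localDensity d P x < ρ + ε} := by
    refine ENNReal.toReal_mono (measure_ne_top _ _) (measure_mono_ae ?_)
    have : ∀ᵐ y ∂P, y ∈ M := by rw [ae_iff]; exact hPM
    filter_upwards [this] with y hy hyb
    refine ⟨hy, ?_⟩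
    have := H x hx y hy (by
      rw [dist_comm]
      have h4 : dist y x ≤ t / 2 := hyb
      have := min_le_right t₁ δ
      linarith)
    linarith
  linarith

end UniformDensity

/-! ### Bernstein inequalities and conditioning on one observation -/

/-- One-sided Bernstein inequality, with a free exponential parameter `l`. -/
theorem pi_real_le_sum_le_exp {Ω : Type*} [MeasurableSpace Ω] (P : Measure Ω)
    [IsProbabilityMeasure P] {f : Ω → ℝ} (hf : AEStronglyMeasurable f P) {B V l : ℝ}
    (hB : ∀ ω, |f ω| ≤ B) (hmean : ∫ ω, f ω ∂P = 0) (hV : ∫ ω, f ω ^ 2 ∂P ≤ V) (n : ℕ)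
    (hl : 0 ≤ l) (hlB : l * B ≤ 1) (T : ℝ) :
    (Measure.pi fun _ : Fin n => P).real {x | T ≤ ∑ i, f (x i)} ≤
      Real.exp (n * (l ^ 2 * V) - l * T) := by
  have hfi : Integrable f P := Integrable.of_bound hf B (ae_of_all _ hB)
  have hfi2 : Integrable (fun ω => f ω ^ 2) P :=
    Integrable.of_bound (hf.pow 2) (B ^ 2) (ae_of_all _ fun ω => by
      rw [Real.norm_eq_abs, abs_pow]; exact pow_le_pow_left₀ (abs_nonneg _) (hB ω) 2)
  -- The elementary bound e^y ≤ 1 + y + y² for |y| ≤ 1; this is where l B ≤ 1 is needed.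
  have hexp : ∀ ω, Real.exp (l * f ω) ≤ 1 + l * f ω + l ^ 2 * f ω ^ 2 := by
    intro ω
    have h1 : |l * f ω| ≤ 1 := by
      rw [abs_mul, abs_of_nonneg hl]
      exact (mul_le_mul_of_nonneg_left (hB ω) hl).trans hlB
    have h2 := (abs_le.1 (Real.abs_exp_sub_one_sub_id_le h1)).2
    rw [mul_pow] at h2; linarith
  have hint : Integrable (fun ω => Real.exp (l * f ω)) P := by
    refine Integrable.of_bound (Real.continuous_exp.comp_aestronglyMeasurable (hf.const_mul l))
      (Real.exp 1) (ae_of_all _ fun ω => ?_)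
    rw [Real.norm_eq_abs, Real.abs_exp, Real.exp_le_exp]
    exact (le_abs_self _).trans (by
      rw [abs_mul, abs_of_nonneg hl]
      exact (mul_le_mul_of_nonneg_left (hB ω) hl).trans hlB)
  have hlin : Integrable (fun ω => 1 + l * f ω) P := (integrable_const 1).add (hfi.const_mul l)
  have hmgf : ∫ ω, Real.exp (l * f ω) ∂P ≤ Real.exp (l ^ 2 * V) := by
    calc ∫ ω, Real.exp (l * f ω) ∂P ≤ ∫ ω, (1 + l * f ω + l ^ 2 * f ω ^ 2) ∂P :=
          integral_mono hint (hlin.add (hfi2.const_mul (l ^ 2))) hexp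
      _ = 1 + l ^ 2 * ∫ ω, f ω ^ 2 ∂P := by
          rw [integral_add hlin (hfi2.const_mul (l ^ 2)),
            integral_add (integrable_const 1) (hfi.const_mul l), integral_const_mul,
            integral_const_mul, hmean]
          simp
      _ ≤ 1 + l ^ 2 * V := by gcongr
      _ ≤ Real.exp (l ^ 2 * V) := by linarith [Real.add_one_le_exp (l ^ 2 * V)]
  have hprod : ∀ x : Fin n → Ω, Real.exp (l * ∑ i, f (x i)) = ∏ i, Real.exp (l * f (x i)) := by
    intro x; rw [Finset.mul_sum, Real.exp_sum]
  have hI : Integrable (fun x : Fin n → Ω => Real.exp (l * ∑ i, f (x i)))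
      (Measure.pi fun _ => P) := by
    simp_rw [hprod]
    exact Integrable.fintype_prod (f := fun _ ω => Real.exp (l * f ω)) fun _ => hint
  refine (ProbabilityTheory.measure_ge_le_exp_mul_mgf T hl hI).trans ?_
  have e : ProbabilityTheory.mgf (fun x : Fin n → Ω => ∑ i, f (x i)) (Measure.pi fun _ => P) l =
      (∫ ω, Real.exp (l * f ω) ∂P) ^ n := by
    rw [ProbabilityTheory.mgf]
    simp_rw [hprod]
    rw [integral_fintype_prod_eq_prod (fun _ ω => Real.exp (l * f ω))]
    simp
  rw [e, sub_eq_neg_add, Real.exp_add, Real.exp_nat_mul, neg_mul]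
  gcongr

/-- Two-sided Bernstein inequality, with a free exponential parameter `l`. -/
theorem pi_real_le_abs_sum_sub_le_exp {Ω : Type*} [MeasurableSpace Ω] (P : Measure Ω)
    [IsProbabilityMeasure P] {f : Ω → ℝ} (hf : AEStronglyMeasurable f P) {B V l : ℝ}
    (hB : ∀ ω, |f ω| ≤ B) (hV : ∫ ω, f ω ^ 2 ∂P ≤ V) (n : ℕ)
    (hl : 0 ≤ l) (hlB : l * (2 * B) ≤ 1) (T : ℝ) :
    (Measure.pi fun _ : Fin n => P).real {x | T ≤ |∑ i, f (x i) - n * ∫ ω, f ω ∂P|} ≤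
      2 * Real.exp (n * (l ^ 2 * V) - l * T) := by
  set m := ∫ ω, f ω ∂P with hm
  have hfi : Integrable f P := Integrable.of_bound hf B (ae_of_all _ hB)
  have hfi2 : Integrable (fun ω => f ω ^ 2) P :=
    Integrable.of_bound (hf.pow 2) (B ^ 2) (ae_of_all _ fun ω => by
      rw [Real.norm_eq_abs, abs_pow]; exact pow_le_pow_left₀ (abs_nonneg _) (hB ω) 2)
  have hmB : |m| ≤ B := by
    have := norm_integral_le_of_norm_le_const (μ := P) (f := f) (C := B) (ae_of_all _ hB)
    simpa using this
  -- Centring at most doubles the sup bound, hence the 2B in the condition on l, and does not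
  -- increase the second moment.
  have hB' : ∀ ω, |f ω - m| ≤ 2 * B := fun ω => (abs_sub _ _).trans (by linarith [hB ω])
  have hmean : ∫ ω, (f ω - m) ∂P = 0 := by
    rw [integral_sub hfi (integrable_const m)]; simp [hm]
  have hV' : ∫ ω, (f ω - m) ^ 2 ∂P ≤ V := by
    have e : ∀ ω, (f ω - m) ^ 2 = f ω ^ 2 - 2 * m * f ω + m ^ 2 := fun ω => by ring
    simp_rw [e]
    have h2 : Integrable (fun ω => f ω ^ 2 - 2 * m * f ω) P := hfi2.sub (hfi.const_mul _)
    rw [integral_add h2 (integrable_const _),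
      integral_sub hfi2 (hfi.const_mul _), integral_const_mul, ← hm]
    simp only [integral_const, probReal_univ, smul_eq_mul]
    nlinarith [sq_nonneg m]
  have hsum : ∀ x : Fin n → Ω, ∑ i, f (x i) - n * m = ∑ i, (f (x i) - m) := fun x => by
    simp [Finset.sum_sub_distrib]
  have h1 := pi_real_le_sum_le_exp P (hf.sub aestronglyMeasurable_const) hB' hmean hV' n hl hlB T
  have h2 := pi_real_le_sum_le_exp P (f := fun ω => -(f ω - m))
    (hf.sub aestronglyMeasurable_const).neg (fun ω => by rw [abs_neg]; exact hB' ω)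
    (by rw [integral_neg, hmean, neg_zero]) (by simpa only [neg_sq] using hV') n hl hlB T
  have hsub : {x : Fin n → Ω | T ≤ |∑ i, f (x i) - n * m|} ⊆
      {x | T ≤ ∑ i, (f (x i) - m)} ∪ {x | T ≤ ∑ i, -(f (x i) - m)} := by
    intro x hx
    have hx : T ≤ |∑ i, f (x i) - n * m| := hx
    rw [hsum, le_abs] at hx
    rcases hx with hx | hx
    · exact Or.inl hx
    · right
      simpa [Finset.sum_neg_distrib] using hx
  refine (measureReal_mono hsub (measure_ne_top _ _)).trans ((measureReal_union_le _ _).trans ?_)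
  rw [two_mul]
  exact add_le_add h1 h2

/-- A bound on the conditional probability of an event given one observation of an i.i.d. sample is
a bound on its probability. -/
theorem pi_real_le_of_ae_section_le {Ω : Type*} [MeasurableSpace Ω] (P : Measure Ω)
    [IsProbabilityMeasure P] {m : ℕ} (i : Fin (m + 1)) {E : Set (Ω × (Fin m → Ω))}
    (hE : MeasurableSet E) {c : ℝ}
    (h : ∀ᵐ y ∂P, (Measure.pi fun _ : Fin m => P).real {z | (y, z) ∈ E} ≤ c) :
    (Measure.pi fun _ : Fin (m + 1) => P).real {x | (x i, fun j => x (i.succAbove j)) ∈ E} ≤ c := by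
  have hmp := measurePreserving_piFinSuccAbove (fun _ : Fin (m + 1) => P) i
  have hc : 0 ≤ c := by
    obtain ⟨y, hy⟩ := h.exists
    exact measureReal_nonneg.trans hy
  have e : {x : Fin (m + 1) → Ω | (x i, fun j => x (i.succAbove j)) ∈ E} =
      MeasurableEquiv.piFinSuccAbove (fun _ => Ω) i ⁻¹' E := rfl
  rw [e, measureReal_def, hmp.measure_preimage hE.nullMeasurableSet, Measure.prod_apply hE]
  refine ENNReal.toReal_le_of_le_ofReal hc ?_
  calc ∫⁻ y, (Measure.pi fun _ : Fin m => P) (Prod.mk y ⁻¹' E) ∂P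
      ≤ ∫⁻ _, ENNReal.ofReal c ∂P := by
        refine lintegral_mono_ae ?_
        filter_upwards [h] with y hy
        exact (ENNReal.le_ofReal_iff_toReal_le (measure_ne_top _ _) hc).2 hy
    _ = ENNReal.ofReal c := by simp

/-! ### The rate and the empirical shell values -/

theorem rate_pow {d n : ℕ} (hn : 1 ≤ n) : rate d n ^ (d + 2) = Real.log n / n := by
  rw [rate, ← Real.rpow_natCast, ← Real.rpow_mul]
  · push_cast
    rw [one_div, inv_mul_cancel₀ (by positivity), Real.rpow_one]
  · have : 0 ≤ Real.log n := Real.log_natCast_nonneg n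
    positivity

theorem rate_pos {d n : ℕ} (hn : 2 ≤ n) : 0 < rate d n := by
  have h1 : (1 : ℝ) < n := by exact_mod_cast hn
  have := Real.log_pos h1
  exact Real.rpow_pos_of_pos (by positivity) _

theorem tendsto_rate (d : ℕ) : Tendsto (rate d) atTop (𝓝 0) := by
  have h1 : Tendsto (fun n : ℕ => Real.log n / n) atTop (𝓝 0) := by
    have := Real.isLittleO_log_id_atTop.tendsto_div_nhds_zero
    exact this.comp tendsto_natCast_atTop_atTop
  have h2 := h1.rpow_const (p := 1 / ((d : ℝ) + 2)) (Or.inr (by positivity))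
  rwa [Real.zero_rpow (by positivity)] at h2

theorem one_le_log_natCast {n : ℕ} (hn : 3 ≤ n) : 1 ≤ Real.log n := by
  rw [Real.le_log_iff_exp_le (by positivity)]
  have : (3 : ℝ) ≤ n := by exact_mod_cast hn
  linarith [Real.exp_one_lt_d9]

theorem natCast_mul_rate_pow {d n : ℕ} (hn : 1 ≤ n) :
    n * rate d n ^ (d + 2) = Real.log n := by
  rw [rate_pow hn]
  have : (n : ℝ) ≠ 0 := by positivity
  field_simp

theorem natCard_mem_eq_sum {D n : ℕ} (x : Fin n → Ambient D) (S : Set (Ambient D)) :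
    (Nat.card {j : Fin n // x j ∈ S} : ℝ) = ∑ j, S.indicator (fun _ => (1 : ℝ)) (x j) := by
  classical
  rw [Nat.card_eq_fintype_card, Fintype.card_subtype]
  simp [Set.indicator_apply]

theorem measurable_closedBall_indicator {D : ℕ} (r : ℝ) :
    Measurable fun p : Ambient D × Ambient D =>
      (Metric.closedBall p.1 r).indicator (fun _ => (1 : ℝ)) p.2 := by
  have hS : MeasurableSet {p : Ambient D × Ambient D | dist p.2 p.1 ≤ r} :=
    measurableSet_le (measurable_snd.dist measurable_fst) measurable_const
  exact (measurable_const (a := (1 : ℝ))).indicator hS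

theorem measurable_measureReal_closedBall {D : ℕ} (P : Measure (Ambient D))
    [IsFiniteMeasure P] (r : ℝ) : Measurable fun y => P.real (Metric.closedBall y r) := by
  have hS : MeasurableSet {p : Ambient D × Ambient D | dist p.2 p.1 ≤ r} :=
    measurableSet_le (measurable_snd.dist measurable_fst) measurable_const
  exact (measurable_measure_prodMk_left hS).ennreal_toReal

theorem measurableSet_le_abs_sum_closedBall_indicator_sub {D : ℕ} (P : Measure (Ambient D))
    [IsFiniteMeasure P] (m : ℕ) (r T : ℝ) :
    MeasurableSet {p : Ambient D × (Fin m → Ambient D) | T ≤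
      |∑ j, (Metric.closedBall p.1 r).indicator (fun _ => (1 : ℝ)) (p.2 j) -
        m * P.real (Metric.closedBall p.1 r)|} := by
  have h1 : ∀ j : Fin m, Measurable fun p : Ambient D × (Fin m → Ambient D) =>
      (Metric.closedBall p.1 r).indicator (fun _ => (1 : ℝ)) (p.2 j) := fun j => by
    have h2 : Measurable fun p : Ambient D × (Fin m → Ambient D) => (p.1, p.2 j) := by fun_prop
    exact Measurable.comp (f := fun p : Ambient D × (Fin m → Ambient D) => (p.1, p.2 j))
      (measurable_closedBall_indicator r) h2
  have h3 : Measurable fun p : Ambient D × (Fin m → Ambient D) =>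
      P.real (Metric.closedBall p.1 r) :=
    Measurable.comp (f := fun p : Ambient D × (Fin m → Ambient D) => p.1)
      (measurable_measureReal_closedBall P r) measurable_fst
  exact measurableSet_le measurable_const
    ((Finset.measurable_sum _ fun j _ => h1 j).sub (h3.const_mul _)).abs

/-- Uniform rate of convergence of the empirical shell values to the local densities. -/
theorem UniformDensity.real_shellValue_sub_le {D d : ℕ} {M : Set (Ambient D)}
    {P : Measure (Ambient D)} [IsProbabilityMeasure P] {ρ t₁ C R : ℝ}
    (h : UniformDensity d M P ρ t₁ C R) (hPM : P Mᶜ = 0) {n : ℕ} (hn : 3 ≤ n)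
    (hr : rate d n ≤ t₁) (hr2 : rate d n ≤ 1 / 2) :
    (sampleLaw P n).real {x | ¬ ∀ i, |shellValue d x i - localDensity d P (x i)| ≤
      (C + 2 * R + 4) * rate d n} ≤ 2 / n ^ 2 := by
  set r := rate d n with hrdef
  have hr0 : 0 < r := rate_pos (by omega)
  have hn0 : (0 : ℝ) < n := by positivity
  have hlog : n * r ^ (d + 2) = Real.log n := natCast_mul_rate_pow (by omega)
  have hR : 0 < R := h.rho_pos.trans_le h.rho_le
  have hM : ∀ᵐ y ∂P, y ∈ M := by rw [ae_iff]; exact hPM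
  -- With exponential parameter l = r and variance at most 2R r^d, the identity n r^(d+2) = log n
  -- makes the exponent at most 2R log n - (2R + 3) log n = -3 log n; a union over the n indices
  -- leaves 2/n².
  set T := n * (2 * R + 3) * r ^ (d + 1) with hT
  obtain ⟨m, rfl⟩ : ∃ m, n = m + 1 := ⟨n - 1, by omega⟩
  set E : Set (Ambient D × (Fin m → Ambient D)) := {p | T ≤
    |∑ j, (Metric.closedBall p.1 (r / 2)).indicator (fun _ => (1 : ℝ)) (p.2 j) -
      m * P.real (Metric.closedBall p.1 (r / 2))|} with hE
  have hEm : MeasurableSet E :=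
    measurableSet_le_abs_sum_closedBall_indicator_sub P m (r / 2) T
  have hsec : ∀ᵐ y ∂P, (Measure.pi fun _ : Fin m => P).real {z | (y, z) ∈ E} ≤
      2 / ((m + 1 : ℕ) : ℝ) ^ 3 := by
    filter_upwards [hM] with y hy
    set S := Metric.closedBall y (r / 2) with hS
    have hSm : MeasurableSet S := Metric.isClosed_closedBall.measurableSet
    have hint : ∫ ω, S.indicator (fun _ => (1 : ℝ)) ω ∂P = P.real S := by
      rw [integral_indicator_const _ hSm]; simp
    have hint2 : ∫ ω, S.indicator (fun _ => (1 : ℝ)) ω ^ 2 ∂P ≤ 2 * R * r ^ d := by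
      have : ∀ ω, S.indicator (fun _ => (1 : ℝ)) ω ^ 2 = S.indicator (fun _ => (1 : ℝ)) ω := by
        intro ω; by_cases hω : ω ∈ S <;> simp [hω]
      simp_rw [this]
      rw [hint]
      exact h.measureReal_ball_le hy ⟨hr0, hr⟩
    have key := pi_real_le_abs_sum_sub_le_exp P (f := S.indicator fun _ => (1 : ℝ))
      (measurable_const.indicator hSm).aestronglyMeasurable (B := 1) (l := r)
      (fun ω => by by_cases hω : ω ∈ S <;> simp [hω]) hint2 m hr0.le (by linarith) T
    rw [hint] at key
    refine key.trans ?_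
    rw [div_eq_mul_inv]
    have e3 : Real.exp (-(3 * Real.log ((m + 1 : ℕ) : ℝ))) = (((m + 1 : ℕ) : ℝ) ^ 3)⁻¹ := by
      rw [Real.exp_neg, ← Real.exp_log (pow_pos hn0 3), Real.log_pow]; norm_num
    rw [← e3]
    gcongr
    have e1 : r * T = (2 * R + 3) * Real.log ((m + 1 : ℕ) : ℝ) := by
      rw [hT, ← hlog]; ring
    have e2 : (m : ℝ) * (r ^ 2 * (2 * R * r ^ d)) ≤ 2 * R * Real.log ((m + 1 : ℕ) : ℝ) := by
      rw [← hlog]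
      have : (m : ℝ) ≤ ((m + 1 : ℕ) : ℝ) := by push_cast; linarith
      calc (m : ℝ) * (r ^ 2 * (2 * R * r ^ d)) ≤ ((m + 1 : ℕ) : ℝ) * (r ^ 2 * (2 * R * r ^ d)) := by
            gcongr
        _ = _ := by ring
    rw [e1]; linarith
  have hMall : ∀ᵐ x ∂(sampleLaw P (m + 1)), ∀ i, x i ∈ M := by
    rw [ae_all_iff]
    exact fun i => (Measure.quasiMeasurePreserving_eval (fun _ => P) i).ae hM
  have hincl : {x : Fin (m + 1) → Ambient D |
      ¬ ∀ i, |shellValue d x i - localDensity d P (x i)| ≤ (C + 2 * R + 4) * r} ≤ᵐ[sampleLaw P (m + 1)]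
      ⋃ i : Fin (m + 1), {x | (x i, fun j => x (i.succAbove j)) ∈ E} := by
    filter_upwards [hMall] with x hxM hx
    by_contra hnot
    refine hx fun i => ?_
    have hi : ¬ T ≤ |∑ j, (Metric.closedBall (x i) (r / 2)).indicator (fun _ => (1 : ℝ))
        (x (i.succAbove j)) - m * P.real (Metric.closedBall (x i) (r / 2))| := fun hT' =>
      hnot (mem_iUnion.2 ⟨i, hT'⟩)
    have hi := abs_lt.1 (not_le.1 hi)
    set p := P.real (Metric.closedBall (x i) (r / 2)) with hp
    have hp0 : 0 ≤ p := measureReal_nonneg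
    have hp1 : p ≤ 1 := measureReal_le_one
    have hV : shellValue d x i = (1 + ∑ j, (Metric.closedBall (x i) (r / 2)).indicator
        (fun _ => (1 : ℝ)) (x (i.succAbove j))) / ((m + 1 : ℕ) : ℝ) / r ^ d := by
      rw [shellValue, rhoHat, natCard_mem_eq_sum, Fin.sum_univ_succAbove _ i,
        Set.indicator_of_mem (Metric.mem_closedBall_self (by positivity))]
    set s := ∑ j, (Metric.closedBall (x i) (r / 2)).indicator (fun _ => (1 : ℝ))
        (x (i.succAbove j)) with hs
    have hap := h.approx (x i) (hxM i) r ⟨hr0, hr⟩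
    have hrd : 0 < r ^ d := pow_pos hr0 d
    -- X_i always counts itself and only m = n - 1 other points are random. The mismatch with n p is
    -- at most 1, which this inequality absorbs: 2R + 3 becomes 2R + 4.
    have h1 : 1 ≤ ((m + 1 : ℕ) : ℝ) * r ^ (d + 1) := by
      calc 1 ≤ Real.log ((m + 1 : ℕ) : ℝ) := one_le_log_natCast hn
        _ = ((m + 1 : ℕ) : ℝ) * r ^ (d + 1) * r := by rw [← hlog]; ring
        _ ≤ ((m + 1 : ℕ) : ℝ) * r ^ (d + 1) * 1 := by gcongr; linarith
        _ = _ := mul_one _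
    have h2 : |(1 + s) - ((m + 1 : ℕ) : ℝ) * p| ≤ ((m + 1 : ℕ) : ℝ) * (2 * R + 4) * r ^ (d + 1) := by
      have e : ((m + 1 : ℕ) : ℝ) * (2 * R + 4) * r ^ (d + 1) = T + ((m + 1 : ℕ) : ℝ) * r ^ (d + 1) := by
        rw [hT]; ring
      have e' : ((m + 1 : ℕ) : ℝ) * p = m * p + p := by push_cast; ring
      rw [e, e', abs_le]
      constructor <;> linarith [hi.1, hi.2]
    have h3 : |(1 + s) / ((m + 1 : ℕ) : ℝ) - p| ≤ (2 * R + 4) * r ^ (d + 1) := by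
      have e : (1 + s) / ((m + 1 : ℕ) : ℝ) - p = ((1 + s) - ((m + 1 : ℕ) : ℝ) * p) / ((m + 1 : ℕ) : ℝ) := by
        field_simp
      rw [e, abs_div, abs_of_pos hn0, div_le_iff₀ hn0]
      calc _ ≤ _ := h2
        _ = _ := by ring
    have h4 : |(1 + s) / ((m + 1 : ℕ) : ℝ) - localDensity d P (x i) * r ^ d| ≤
        (C + 2 * R + 4) * r ^ (d + 1) := by
      calc _ ≤ |(1 + s) / ((m + 1 : ℕ) : ℝ) - p| + |p - localDensity d P (x i) * r ^ d| :=
            abs_sub_le _ _ _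
        _ ≤ (2 * R + 4) * r ^ (d + 1) + C * r ^ (d + 1) := add_le_add h3 hap
        _ = _ := by ring
    have e : shellValue d x i - localDensity d P (x i) =
        ((1 + s) / ((m + 1 : ℕ) : ℝ) - localDensity d P (x i) * r ^ d) / r ^ d := by
      rw [hV]; field_simp
    rw [e, abs_div, abs_of_pos hrd, div_le_iff₀ hrd]
    calc _ ≤ _ := h4
      _ = _ := by ring
  calc (sampleLaw P (m + 1)).real _
      ≤ (sampleLaw P (m + 1)).real
        (⋃ i : Fin (m + 1), {x | (x i, fun j => x (i.succAbove j)) ∈ E}) :=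
        have : IsProbabilityMeasure (sampleLaw P (m + 1)) := by unfold sampleLaw; infer_instance
        ENNReal.toReal_mono (measure_ne_top _ _) (measure_mono_ae hincl)
    _ ≤ ∑ i : Fin (m + 1), (sampleLaw P (m + 1)).real
        {x | (x i, fun j => x (i.succAbove j)) ∈ E} := measureReal_iUnion_fintype_le _
    _ ≤ ∑ i : Fin (m + 1), 2 / ((m + 1 : ℕ) : ℝ) ^ 3 :=
        Finset.sum_le_sum fun i _ => pi_real_le_of_ae_section_le P i hEm hsec
    _ = 2 / ((m + 1 : ℕ) : ℝ) ^ 2 := by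
        rw [Finset.sum_const, Finset.card_univ, Fintype.card_fin, nsmul_eq_mul]
        field_simp

/-! ### Smoothing kernels: boundedness, decay and bias -/

namespace IsSmoothingKernel

variable {K : ℝ → ℝ}

theorem continuous (hK : IsSmoothingKernel K) : Continuous K :=
  hK.lipschitz.choose_spec.continuous

theorem integrable_sq_mul_abs (hK : IsSmoothingKernel K) : Integrable fun u => u ^ 2 * |K u| := by
  refine hK.second_moment.abs.congr (ae_of_all _ fun u => ?_)
  simp [abs_mul]

/-- A Lipschitz kernel with a second moment is bounded, and decays at least like `1 / |u|`. -/
theorem exists_bound (hK : IsSmoothingKernel K) :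
    ∃ B > 0, (∀ u, |K u| ≤ B) ∧ ∀ u, |u| * |K u| ≤ B := by
  obtain ⟨L₀, hL₀⟩ := hK.lipschitz
  set L : ℝ := L₀ + 1 with hL
  have hLpos : 0 < L := by positivity
  have hlip : ∀ u v, |K u - K v| ≤ L * |u - v| := fun u v => by
    have := hL₀.dist_le_mul u v
    rw [Real.dist_eq, Real.dist_eq] at this
    nlinarith [abs_nonneg (u - v)]
  set F : ℝ → ℝ := fun u => |K u| + u ^ 2 * |K u| with hF
  have hFi : Integrable F := hK.integrable.abs.add hK.integrable_sq_mul_abs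
  have hF0 : ∀ u, 0 ≤ F u := fun u => by positivity
  set I := ∫ u, F u with hI
  have hI0 : 0 ≤ I := integral_nonneg hF0
  -- If |K u| = m, then |K| ≥ m/2 on [u, u + m/(2L)], where also w² ≥ u². The integral I of (1 +
  -- w²)|K w| is therefore at least (1 + u²) m² / (4L). Negative u follow by symmetry.
  have key : ∀ u, 0 ≤ u → (1 + u ^ 2) * |K u| ^ 2 ≤ 4 * L * I := by
    intro u hu
    rcases (abs_nonneg (K u)).eq_or_lt with hm | hm
    · rw [← hm]; simp; positivity
    set m := |K u| with hmdef
    set δ := m / (2 * L) with hδ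
    have hδpos : 0 < δ := by positivity
    have hLδ : L * δ = m / 2 := by rw [hδ]; field_simp
    have h1 : ∫ _ in Icc u (u + δ), (1 + u ^ 2) * (m / 2) ≤ ∫ w in Icc u (u + δ), F w := by
      refine setIntegral_mono_on (integrableOn_const (by simp)) hFi.integrableOn
        measurableSet_Icc fun w hw => ?_
      have h2 : m / 2 ≤ |K w| := by
        have h3 := hlip u w
        have h4 : |u - w| ≤ δ := by
          rw [abs_sub_comm, abs_of_nonneg (by linarith [hw.1])]; linarith [hw.2]
        have h5 : L * |u - w| ≤ m / 2 := by rw [← hLδ]; gcongr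
        have h6 := abs_sub_abs_le_abs_sub (K u) (K w)
        linarith
      have h7 : u ^ 2 ≤ w ^ 2 := pow_le_pow_left₀ hu hw.1 2
      calc (1 + u ^ 2) * (m / 2) ≤ (1 + w ^ 2) * |K w| := by gcongr
        _ = F w := by rw [hF]; ring
    have h2 : ∫ w in Icc u (u + δ), F w ≤ I :=
      setIntegral_le_integral hFi (ae_of_all _ hF0)
    rw [setIntegral_const] at h1
    simp only [Real.volume_real_Icc, smul_eq_mul, add_sub_cancel_left,
      max_eq_left hδpos.le] at h1
    have h3 : δ * ((1 + u ^ 2) * (m / 2)) ≤ I := h1.trans h2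
    calc (1 + u ^ 2) * m ^ 2 = 4 * L * (δ * ((1 + u ^ 2) * (m / 2))) := by
          rw [hδ]; field_simp; ring
      _ ≤ 4 * L * I := by gcongr
  have key' : ∀ u, (1 + u ^ 2) * |K u| ^ 2 ≤ 4 * L * I := by
    intro u
    rcases le_total 0 u with hu | hu
    · exact key u hu
    · have := key (-u) (by linarith)
      rwa [hK.symmetric, neg_sq] at this
  refine ⟨√(4 * L * I) + 1, by positivity, fun u => ?_, fun u => ?_⟩
  · refine (Real.le_sqrt_of_sq_le ?_).trans (le_add_of_nonneg_right zero_le_one)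
    nlinarith [key' u, mul_nonneg (sq_nonneg u) (sq_nonneg |K u|)]
  · refine (Real.le_sqrt_of_sq_le ?_).trans (le_add_of_nonneg_right zero_le_one)
    rw [mul_pow, sq_abs u]
    nlinarith [key' u, sq_nonneg |K u|]

theorem integrable_mul (hK : IsSmoothingKernel K) : Integrable fun u => u * K u := by
  refine (hK.integrable.abs.add hK.integrable_sq_mul_abs).mono'
    (continuous_id.mul hK.continuous).aestronglyMeasurable (ae_of_all _ fun u => ?_)
  simp only [Real.norm_eq_abs, abs_mul, Pi.add_apply]
  have : |u| ≤ 1 + u ^ 2 := by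
    rw [← sq_abs u]; nlinarith [sq_nonneg (|u| - 1), abs_nonneg u]
  nlinarith [abs_nonneg (K u), mul_le_mul_of_nonneg_right this (abs_nonneg (K u))]

theorem integral_mul_eq_zero (hK : IsSmoothingKernel K) : ∫ u, u * K u = 0 := by
  have h := integral_neg_eq_self (fun u => u * K u) volume
  simp only [hK.symmetric, neg_mul, integral_neg] at h
  linarith

end IsSmoothingKernel

/-- Substitution y = v - b u. -/
theorem integral_rescale {b : ℝ} (hb : 0 < b) (v : ℝ) (k f : ℝ → ℝ) :
    ∫ y, (1 / b) * k ((v - y) / b) * f y = ∫ u, k u * f (v - b * u) := by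
  have h1 := integral_sub_left_eq_self (fun w => k (w / b) * f (v - w)) volume v
  have h2 := Measure.integral_comp_mul_left (fun w => k (w / b) * f (v - w)) b
  simp only [mul_div_cancel_left₀ _ hb.ne', sub_sub_cancel, abs_of_pos (inv_pos.2 hb),
    smul_eq_mul] at h1 h2
  rw [h2, ← h1, ← integral_const_mul]
  simp only [one_div, mul_assoc]

/-- Mean value inequality for s ↦ g(v + s) - s g'(v) on |s| ≤ |h|, whose derivative is at most L|h|.
The sharp constant L/2 is not needed. -/
theorem abs_taylor_remainder_le {g : ℝ → ℝ} (hg : Differentiable ℝ g) {L : ℝ≥0}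
    (hL : LipschitzWith L (deriv g)) (v h : ℝ) :
    |g (v + h) - g v - h * deriv g v| ≤ L * h ^ 2 := by
  have hd : ∀ s, HasDerivAt (fun s => g (v + s) - s * deriv g v) (deriv g (v + s) - deriv g v) s := by
    intro s
    have h1 : HasDerivAt (fun s => g (v + s)) (deriv g (v + s)) s :=
      HasDerivAt.comp_const_add v s (hg (v + s)).hasDerivAt
    exact (h1.sub ((hasDerivAt_id s).mul_const (deriv g v))).congr_deriv (by simp)
  have := (convex_closedBall (0 : ℝ) |h|).norm_image_sub_le_of_norm_hasDerivWithin_le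
    (fun s _ => (hd s).hasDerivWithinAt) (C := L * |h|) (fun s hs => by
      have h1 := hL.dist_le_mul (v + s) v
      rw [dist_eq_norm, Real.dist_eq] at h1
      refine h1.trans ?_
      have h2 : |s| ≤ |h| := by simpa using hs
      simpa using mul_le_mul_of_nonneg_left h2 L.2)
    (Metric.mem_closedBall_self (abs_nonneg h)) (show h ∈ Metric.closedBall 0 |h| by simp)
  simp only [Real.norm_eq_abs, add_zero, zero_mul, sub_zero] at this
  calc |g (v + h) - g v - h * deriv g v| = |g (v + h) - h * deriv g v - g v| := by congr 1; ring
    _ ≤ L * |h| * |h| := this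
    _ = L * h ^ 2 := by rw [mul_assoc, ← sq, sq_abs]

/-- The bias of a kernel smoother of second order. -/
theorem IsSmoothingKernel.abs_integral_sub_le {K : ℝ → ℝ} (hK : IsSmoothingKernel K) {g : ℝ → ℝ}
    (hg : Differentiable ℝ g) {L : ℝ≥0} (hL : LipschitzWith L (deriv g)) {G : ℝ}
    (hG : ∀ v, |g v| ≤ G) {b : ℝ} (hb : 0 < b) (v : ℝ) :
    |(∫ y, (1 / b) * K ((v - y) / b) * g y) - g v| ≤ (L * ∫ u, u ^ 2 * |K u|) * b ^ 2 := by
  rw [integral_rescale hb]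
  have hi : Integrable fun u => K u * g (v - b * u) :=
    hK.integrable.mul_bdd (c := G)
      (hg.continuous.comp (by fun_prop)).aestronglyMeasurable
      (ae_of_all _ fun u => hG _)
  have e : (∫ u, K u * g (v - b * u)) - g v =
      ∫ u, K u * (g (v + -(b * u)) - g v - -(b * u) * deriv g v) := by
    have e1 : ∀ u, K u * (g (v + -(b * u)) - g v - -(b * u) * deriv g v) =
        K u * g (v - b * u) - K u * g v + u * K u * (b * deriv g v) := fun u => by
      rw [← sub_eq_add_neg]; ring
    simp_rw [e1]
    have hi2 : Integrable fun u => K u * g (v - b * u) - K u * g v :=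
      hi.sub (hK.integrable.mul_const _)
    rw [integral_add hi2 (hK.integrable_mul.mul_const _),
      integral_sub hi (hK.integrable.mul_const _), integral_mul_const, integral_mul_const,
      hK.integral_eq_one, hK.integral_mul_eq_zero]
    ring
  rw [e]
  calc |∫ u, K u * (g (v + -(b * u)) - g v - -(b * u) * deriv g v)|
      ≤ ∫ u, L * b ^ 2 * (u ^ 2 * |K u|) := by
        rw [← Real.norm_eq_abs]
        refine norm_integral_le_of_norm_le (hK.integrable_sq_mul_abs.const_mul _)
          (ae_of_all _ fun u => ?_)
        rw [Real.norm_eq_abs, abs_mul]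
        calc |K u| * |g (v + -(b * u)) - g v - -(b * u) * deriv g v|
            ≤ |K u| * (L * (-(b * u)) ^ 2) := by
              gcongr; exact abs_taylor_remainder_le hg hL v _
          _ = L * b ^ 2 * (u ^ 2 * |K u|) := by ring
    _ = _ := by rw [integral_const_mul]; ring

/-! ### The density of the local density -/

namespace IsShellDensity

variable {D d : ℕ} {M : Set (Ambient D)} {P : Measure (Ambient D)} {g : ℝ → ℝ}

theorem integral_comp_localDensity (hg : IsShellDensity d P g)
    (hq : AEMeasurable (localDensity d P) P) {f : ℝ → ℝ} (hf : Measurable f) :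
    ∫ x, f (localDensity d P x) ∂P = ∫ v, f v * g v := by
  rw [← integral_map hq hf.aestronglyMeasurable, hg.law,
    integral_withDensity_eq_integral_toReal_smul hg.measurable.ennreal_ofReal
      (ae_of_all _ fun v => ENNReal.ofReal_lt_top)]
  refine integral_congr_ae (ae_of_all _ fun v => ?_)
  simp [ENNReal.toReal_ofReal (hg.nonneg v), mul_comm]

theorem measure_preimage_eq (hg : IsShellDensity d P g)
    (hq : AEMeasurable (localDensity d P) P) {S : Set ℝ} (hS : MeasurableSet S) :
    P (localDensity d P ⁻¹' S) = ∫⁻ v in S, ENNReal.ofReal (g v) := by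
  rw [← Measure.map_apply_of_aemeasurable hq hS, hg.law, withDensity_apply _ hS]

/-- A continuous shell density vanishes outside the range of the local density. -/
theorem eq_zero_of_notMem {ρ t₁ C R : ℝ} [IsProbabilityMeasure P]
    (h : UniformDensity d M P ρ t₁ C R) (hPM : P Mᶜ = 0) (hg : IsShellDensity d P g)
    (hq : AEMeasurable (localDensity d P) P) (hgc : Continuous g) {v : ℝ} (hv : v ∉ Icc ρ R) :
    g v = 0 := by
  have h1 := hg.measure_preimage_eq hq (S := (Icc ρ R)ᶜ) measurableSet_Icc.compl
  have h2 : P (localDensity d P ⁻¹' (Icc ρ R)ᶜ) = 0 := by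
    refine measure_mono_null (t := Mᶜ) (fun x hx hxM => hx ?_) hPM
    exact ⟨h.lower_le x hxM, h.le_upper x hxM⟩
  rw [h2, eq_comm, lintegral_eq_zero_iff hg.measurable.ennreal_ofReal] at h1
  have h3 : g =ᵐ[volume.restrict (Icc ρ R)ᶜ] fun _ => 0 := by
    filter_upwards [h1] with w hw
    have : g w ≤ 0 := ENNReal.ofReal_eq_zero.1 hw
    exact le_antisymm this (hg.nonneg w)
  -- Continuity upgrades vanishing almost everywhere on an open set to vanishing everywhere on it.
  exact Measure.eqOn_open_of_ae_eq h3 isClosed_Icc.isOpen_compl hgc.continuousOn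
    continuousOn_const hv

theorem exists_bound {ρ t₁ C R : ℝ} [IsProbabilityMeasure P]
    (h : UniformDensity d M P ρ t₁ C R) (hPM : P Mᶜ = 0) (hg : IsShellDensity d P g)
    (hq : AEMeasurable (localDensity d P) P) (hgc : Continuous g) :
    ∃ G > 0, ∀ v, |g v| ≤ G := by
  obtain ⟨G, hG⟩ := (isCompact_Icc (a := ρ) (b := R)).exists_bound_of_continuousOn hgc.continuousOn
  refine ⟨|G| + 1, by positivity, fun v => ?_⟩
  by_cases hv : v ∈ Icc ρ R
  · have := hG v hv
    rw [Real.norm_eq_abs] at this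
    linarith [le_abs_self G]
  · rw [hg.eq_zero_of_notMem h hPM hq hgc hv]; simp; positivity

end IsShellDensity

/-! ### Uniform deviation of kernel averages -/

/-- Source of the r / b² term: moving a kernel centre by η changes b⁻¹ K(·/b) by at most L η / b².
-/
theorem abs_gHat_sub_le {D n d : ℕ} (hn : 0 < n) {K : ℝ → ℝ} {L : ℝ≥0} (hL : LipschitzWith L K)
    {b : ℝ} (hb : 0 < b) (x : Fin n → Ambient D) (q : Fin n → ℝ) {η : ℝ}
    (hη : ∀ i, |shellValue d x i - q i| ≤ η) (v : ℝ) :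
    |gHat d K b x v - 1 / n * ∑ i, 1 / b * K ((v - q i) / b)| ≤ L * η / b ^ 2 := by
  have hn' : (0 : ℝ) < n := by exact_mod_cast hn
  rw [gHat, ← mul_sub, ← Finset.sum_sub_distrib, abs_mul, abs_of_pos (by positivity)]
  have h1 : ∀ i ∈ Finset.univ, |1 / b * K ((v - shellValue d x i) / b) - 1 / b * K ((v - q i) / b)|
      ≤ L * η / b ^ 2 := by
    intro i _
    rw [← mul_sub, abs_mul, abs_of_pos (show 0 < 1 / b by positivity)]
    have h2 := hL.dist_le_mul ((v - shellValue d x i) / b) ((v - q i) / b)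
    rw [Real.dist_eq, Real.dist_eq, ← sub_div, abs_div, abs_of_pos hb,
      show v - shellValue d x i - (v - q i) = -(shellValue d x i - q i) by ring, abs_neg] at h2
    calc 1 / b * |K ((v - shellValue d x i) / b) - K ((v - q i) / b)|
        ≤ 1 / b * (L * (|shellValue d x i - q i| / b)) := by gcongr
      _ ≤ 1 / b * (L * (η / b)) := by gcongr; exact hη i
      _ = L * η / b ^ 2 := by field_simp
  calc 1 / (n : ℝ) * |∑ i, _| ≤ 1 / n * ∑ _i : Fin n, L * η / b ^ 2 := by
        gcongr
        exact (Finset.abs_sum_le_sum_abs _ _).trans (Finset.sum_le_sum h1)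
    _ = L * η / b ^ 2 := by
        rw [Finset.sum_const, Finset.card_univ, Fintype.card_fin, nsmul_eq_mul]
        field_simp

noncomputable section

/-- The rescaled kernel `b⁻¹ K((v - y) / b)`. -/
def rescaledKernel (K : ℝ → ℝ) (b v y : ℝ) : ℝ := 1 / b * K ((v - y) / b)

/-- The centred kernel average of the values `q (x i)`. -/
def kernelDeviation {Ω : Type*} [MeasurableSpace Ω] (P : Measure Ω) (q : Ω → ℝ) (K : ℝ → ℝ)
    (b : ℝ) {n : ℕ} (x : Fin n → Ω) (v : ℝ) : ℝ :=
  1 / n * ∑ i, rescaledKernel K b v (q (x i)) - ∫ y, rescaledKernel K b v (q y) ∂P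

end

section

variable {K : ℝ → ℝ} {B b : ℝ}

theorem abs_rescaledKernel_le (hB : ∀ u, |K u| ≤ B) (hb : 0 < b) (v y : ℝ) :
    |rescaledKernel K b v y| ≤ B / b := by
  rw [rescaledKernel, abs_mul, abs_of_pos (show 0 < 1 / b by positivity), one_div_mul_eq_div]
  gcongr; exact hB _

theorem abs_rescaledKernel_sub_le {L : ℝ≥0} (hL : LipschitzWith L K) (hb : 0 < b) (v w y : ℝ) :
    |rescaledKernel K b v y - rescaledKernel K b w y| ≤ L / b ^ 2 * |v - w| := by
  rw [rescaledKernel, rescaledKernel, ← mul_sub, abs_mul, abs_of_pos (show 0 < 1 / b by positivity)]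
  have h2 := hL.dist_le_mul ((v - y) / b) ((w - y) / b)
  rw [Real.dist_eq, Real.dist_eq, ← sub_div, abs_div, abs_of_pos hb, sub_sub_sub_cancel_right] at h2
  calc 1 / b * |K ((v - y) / b) - K ((w - y) / b)| ≤ 1 / b * (L * (|v - w| / b)) := by gcongr
    _ = L / b ^ 2 * |v - w| := by field_simp

theorem abs_rescaledKernel_le_of_le_abs_sub (hB : ∀ u, |u| * |K u| ≤ B) (hb : 0 < b) {s v y : ℝ}
    (hs : 0 < s) (hsv : s ≤ |v - y|) : |rescaledKernel K b v y| ≤ B / s := by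
  rw [rescaledKernel, abs_mul, abs_of_pos (show 0 < 1 / b by positivity)]
  have h1 := hB ((v - y) / b)
  rw [abs_div, abs_of_pos hb] at h1
  rw [le_div_iff₀ hs]
  calc 1 / b * |K ((v - y) / b)| * s ≤ 1 / b * |K ((v - y) / b)| * |v - y| := by gcongr
    _ = |v - y| / b * |K ((v - y) / b)| := by ring
    _ ≤ B := h1

theorem continuous_rescaledKernel (hK : Continuous K) (b v : ℝ) :
    Continuous (rescaledKernel K b v) := by
  unfold rescaledKernel; fun_prop

variable {Ω : Type*} [MeasurableSpace Ω] {P : Measure Ω} [IsProbabilityMeasure P] {q : Ω → ℝ}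

theorem integrable_rescaledKernel_comp (hK : Continuous K) (hB : ∀ u, |K u| ≤ B) (hb : 0 < b)
    (hq : AEMeasurable q P) (v : ℝ) : Integrable (fun y => rescaledKernel K b v (q y)) P :=
  Integrable.of_bound
    ((continuous_rescaledKernel hK b v).measurable.comp_aemeasurable hq).aestronglyMeasurable
    (B / b) (ae_of_all _ fun y => abs_rescaledKernel_le hB hb v (q y))

theorem abs_average_le {n : ℕ} (hn : 0 < n) {f : Fin n → ℝ} {c : ℝ} (hf : ∀ i, |f i| ≤ c) :
    |1 / (n : ℝ) * ∑ i, f i| ≤ c := by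
  have hn' : (0 : ℝ) < n := by exact_mod_cast hn
  rw [abs_mul, abs_of_pos (by positivity)]
  calc 1 / (n : ℝ) * |∑ i, f i| ≤ 1 / n * ∑ _i : Fin n, c := by
        gcongr
        exact (Finset.abs_sum_le_sum_abs _ _).trans (Finset.sum_le_sum fun i _ => hf i)
    _ = c := by
        rw [Finset.sum_const, Finset.card_univ, Fintype.card_fin, nsmul_eq_mul]
        field_simp

theorem abs_integral_le_of_ae_abs_le {f : Ω → ℝ} {c : ℝ} (hf : ∀ᵐ y ∂P, |f y| ≤ c) :
    |∫ y, f y ∂P| ≤ c := by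
  have := norm_integral_le_of_norm_le_const (μ := P) (f := f) (C := c) hf
  simpa using this

/-- Used to pass from the grid to all v. -/
theorem abs_kernelDeviation_sub_le (hK : Continuous K) (hB : ∀ u, |K u| ≤ B) {L : ℝ≥0}
    (hL : LipschitzWith L K) (hb : 0 < b) (hq : AEMeasurable q P) {n : ℕ} (hn : 0 < n)
    (x : Fin n → Ω) (v w : ℝ) :
    |kernelDeviation P q K b x v - kernelDeviation P q K b x w| ≤ 2 * (L / b ^ 2 * |v - w|) := by
  have e : kernelDeviation P q K b x v - kernelDeviation P q K b x w =
      1 / n * ∑ i, (rescaledKernel K b v (q (x i)) - rescaledKernel K b w (q (x i))) -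
      ∫ y, (rescaledKernel K b v (q y) - rescaledKernel K b w (q y)) ∂P := by
    rw [integral_sub (integrable_rescaledKernel_comp hK hB hb hq v)
      (integrable_rescaledKernel_comp hK hB hb hq w), Finset.sum_sub_distrib, kernelDeviation,
      kernelDeviation]
    ring
  rw [e, two_mul]
  refine (abs_sub _ _).trans (add_le_add ?_ ?_)
  · exact abs_average_le hn fun i => abs_rescaledKernel_sub_le hL hb v w _
  · exact abs_integral_le_of_ae_abs_le (ae_of_all _ fun y => abs_rescaledKernel_sub_le hL hb v w _)

/-- All values of q lie at distance at least s from such a v, so the 1/|u| decay of K applies to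
every term. This confines the supremum over v to a bounded interval. -/
theorem abs_kernelDeviation_le_of_far (hB : ∀ u, |u| * |K u| ≤ B) (hb : 0 < b) {n : ℕ} (hn : 0 < n)
    {x : Fin n → Ω} {R s v : ℝ} (hs : 0 < s) (hx : ∀ i, |q (x i)| ≤ R) (hq : ∀ᵐ y ∂P, |q y| ≤ R)
    (hv : R + s ≤ |v|) : |kernelDeviation P q K b x v| ≤ 2 * (B / s) := by
  have hfar : ∀ y, |y| ≤ R → s ≤ |v - y| := fun y hy => by
    have := abs_sub_abs_le_abs_sub v y
    linarith
  rw [two_mul]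
  refine (abs_sub _ _).trans (add_le_add ?_ ?_)
  · exact abs_average_le hn fun i =>
      abs_rescaledKernel_le_of_le_abs_sub hB hb hs (hfar _ (hx i))
  · refine abs_integral_le_of_ae_abs_le ?_
    filter_upwards [hq] with y hy
    exact abs_rescaledKernel_le_of_le_abs_sub hB hb hs (hfar _ hy)

/-- Pointwise deviation bound for kernel averages. -/
theorem real_le_abs_kernelDeviation_le (hK : Continuous K) (hB : ∀ u, |K u| ≤ B) (hb : 0 < b)
    (hq : AEMeasurable q P) {S : ℝ} {v : ℝ}
    (hS : ∫ y, rescaledKernel K b v (q y) ^ 2 ∂P ≤ S / b) {n : ℕ} (hn : 1 ≤ n)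
    (hsmall : √(Real.log n / (n * b)) * (2 * B) ≤ 1) :
    (Measure.pi fun _ : Fin n => P).real
      {x | (S + 7) * √(Real.log n / (n * b)) ≤ |kernelDeviation P q K b x v|} ≤ 2 / n ^ 7 := by
  have hn' : (0 : ℝ) < n := by exact_mod_cast hn
  set s := √(Real.log n / (n * b)) with hs
  have hs0 : 0 ≤ s := Real.sqrt_nonneg _
  have hs2 : n * b * s ^ 2 = Real.log n := by
    rw [hs, Real.sq_sqrt (div_nonneg (Real.log_natCast_nonneg n) (by positivity))]
    field_simp
  -- With l = s b and n b s² = log n the exponent is S log n - (S + 7) log n. The power n^(-7) pays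
  -- for a grid of at most n^5 points and leaves n^(-2).
  have key := pi_real_le_abs_sum_sub_le_exp P (f := fun y => rescaledKernel K b v (q y))
    (integrable_rescaledKernel_comp hK hB hb hq v).aestronglyMeasurable
    (fun y => abs_rescaledKernel_le hB hb v (q y)) hS n (l := s * b) (by positivity)
    (by rw [show s * b * (2 * (B / b)) = s * (2 * B) by field_simp]; exact hsmall)
    (n * ((S + 7) * s))
  have e : (n : ℝ) * ((s * b) ^ 2 * (S / b)) - s * b * (n * ((S + 7) * s)) =
      -(7 * Real.log n) := by
    rw [← hs2]; field_simp; ring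
  have e3 : Real.exp (-(7 * Real.log n)) = ((n : ℝ) ^ 7)⁻¹ := by
    rw [Real.exp_neg, ← Real.exp_log (pow_pos hn' 7), Real.log_pow]; norm_num
  rw [e, e3, ← div_eq_mul_inv] at key
  refine le_trans (le_of_eq ?_) key
  congr 1
  ext x
  have e4 : ∑ i, rescaledKernel K b v (q (x i)) - n * ∫ y, rescaledKernel K b v (q y) ∂P =
      n * kernelDeviation P q K b x v := by
    rw [kernelDeviation]; field_simp
  simp only [mem_ofPred_eq]
  rw [e4, abs_mul, abs_of_pos hn', mul_le_mul_iff_right₀ hn']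

/-- Uniform deviation bound for kernel averages, by a union bound over a grid. -/
theorem real_not_abs_kernelDeviation_le (hK : Continuous K) (hB : ∀ u, |K u| ≤ B)
    (hB' : ∀ u, |u| * |K u| ≤ B) {L : ℝ≥0} (hL : LipschitzWith L K) (hb : 0 < b) (hb1 : b ≤ 1)
    (hq : AEMeasurable q P) {R : ℝ} (hqR : ∀ᵐ y ∂P, |q y| ≤ R) {S : ℝ}
    (hS : ∀ v, ∫ y, rescaledKernel K b v (q y) ^ 2 ∂P ≤ S / b) {n : ℕ} (hn : 3 ≤ n)
    (hsmall : √(Real.log n / (n * b)) * (2 * B) ≤ 1) (hnR : R ≤ n) (hnb : 1 ≤ n * b ^ 2)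
    (hnL : 2 * L ≤ √n) (hnB : 2 * B ≤ √n) :
    (Measure.pi fun _ : Fin n => P).real
      {x | ¬ ∀ v, |kernelDeviation P q K b x v| ≤ (S + 8) * √(Real.log n / (n * b))} ≤ 2 / n ^ 2 := by
  have hn1 : 1 ≤ n := by omega
  have hn' : (0 : ℝ) < n := by positivity
  have hn3 : (3 : ℝ) ≤ n := by exact_mod_cast hn
  set s := √(Real.log n / (n * b)) with hs
  have hs0 : 0 ≤ s := Real.sqrt_nonneg _
  have hns : √n ≤ n * s := by
    have h1 : √(1 / (n : ℝ)) ≤ s := by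
      refine Real.sqrt_le_sqrt ?_
      gcongr
      · exact one_le_log_natCast hn
      · nlinarith
    have h2 : (n : ℝ) * √(1 / (n : ℝ)) = √n := by
      rw [Real.sqrt_div zero_le_one, Real.sqrt_one, mul_one_div, Real.div_sqrt]
    rw [← h2]; gcongr
  -- Grid points k / n² with |k| ≤ n^4: spacing 1/n², and more than enough to reach |v| ≤ 2n.
  set I : Finset ℤ := Finset.Icc (-(n : ℤ) ^ 4) ((n : ℤ) ^ 4) with hI
  have hcard : (I.card : ℝ) ≤ n ^ 5 := by
    have h1 : (I.card : ℝ) = 2 * n ^ 4 + 1 := by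
      rw [hI, Int.card_Icc]
      have h0 : (0 : ℤ) ≤ (n : ℤ) ^ 4 + 1 - -(n : ℤ) ^ 4 := by
        have : (0 : ℤ) ≤ (n : ℤ) ^ 4 := by positivity
        linarith
      have : (((((n : ℤ) ^ 4 + 1 - -(n : ℤ) ^ 4).toNat : ℕ) : ℤ) : ℝ) = 2 * n ^ 4 + 1 := by
        rw [Int.toNat_of_nonneg h0]; push_cast; ring
      exact_mod_cast this
    have h2 : (1 : ℝ) ≤ n ^ 4 := one_le_pow₀ (by linarith)
    rw [h1, pow_succ]
    nlinarith
  have hall : ∀ᵐ x ∂(Measure.pi fun _ : Fin n => P), ∀ i, |q (x i)| ≤ R := by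
    rw [ae_all_iff]
    exact fun i => (Measure.quasiMeasurePreserving_eval (fun _ => P) i).ae hqR
  have hincl : {x : Fin n → Ω | ¬ ∀ v, |kernelDeviation P q K b x v| ≤ (S + 8) * s}
      ≤ᵐ[Measure.pi fun _ : Fin n => P]
      ⋃ k ∈ I, {x | (S + 7) * s ≤ |kernelDeviation P q K b x ((k : ℝ) / n ^ 2)|} := by
    filter_upwards [hall] with x hxR hx
    by_contra hnot
    have hgrid : ∀ k ∈ I, |kernelDeviation P q K b x ((k : ℝ) / n ^ 2)| ≤ (S + 7) * s := by
      intro k hk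
      by_contra! hlt
      exact hnot (mem_iUnion₂.2 ⟨k, hk, hlt.le⟩)
    refine hx fun v => ?_
    -- Both the decay error for far v and the rounding error for the others are O(1/n), and 1/√n ≤ s
    -- makes them at most s; this turns S + 7 into S + 8.
    rcases le_total (R + n) |v| with hv | hv
    · refine (abs_kernelDeviation_le_of_far hB' hb (by omega) hn' hxR hqR hv).trans ?_
      have h1 : 2 * (B / n) ≤ s := by
        rw [← mul_div_assoc, div_le_iff₀ hn', mul_comm s]; exact hnB.trans hns
      have h2 : 0 ≤ (S + 7) * s := (abs_nonneg _).trans (hgrid 0 (by simp [hI]))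
      linarith
    · set k := ⌊v * n ^ 2⌋ with hk
      have hk1 : (k : ℝ) ≤ v * n ^ 2 := Int.floor_le _
      have hk2 : v * n ^ 2 < k + 1 := Int.lt_floor_add_one _
      have hv2 : |v| ≤ 2 * n := by linarith
      obtain ⟨hva, hvb⟩ := abs_le.1 hv2
      have hn2 : (0 : ℝ) < (n : ℝ) ^ 2 := by positivity
      have h4 : 2 * (n : ℝ) ^ 3 + 1 ≤ n ^ 4 := by
        have : (1 : ℝ) ≤ n ^ 3 := one_le_pow₀ (by linarith)
        nlinarith
      have hkI : k ∈ I := by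
        rw [hI, Finset.mem_Icc]
        constructor
        · have : -(n : ℝ) ^ 4 ≤ k := by nlinarith
          exact_mod_cast this
        · have : (k : ℝ) ≤ (n : ℝ) ^ 4 := by nlinarith
          exact_mod_cast this
      have hd : |v - k / n ^ 2| ≤ 1 / n ^ 2 := by
        have e : v - k / (n : ℝ) ^ 2 = (v * n ^ 2 - k) / n ^ 2 := by field_simp
        rw [e, abs_div, abs_of_pos hn2, abs_of_nonneg (by linarith)]
        gcongr; linarith
      have h5 := abs_kernelDeviation_sub_le hK hB hL hb hq (by omega : 0 < n) x v (k / n ^ 2)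
      have h6 : 2 * (L / b ^ 2 * |v - k / n ^ 2|) ≤ s := by
        calc 2 * (L / b ^ 2 * |v - k / n ^ 2|) ≤ 2 * (L / b ^ 2 * (1 / n ^ 2)) := by gcongr
          _ = 2 * L * (1 / (n * b ^ 2)) / n := by field_simp
          _ ≤ 2 * L * 1 / n := by
              gcongr
              rw [div_le_one (by positivity)]; exact hnb
          _ ≤ s := by
              rw [div_le_iff₀ hn', mul_comm s, mul_one]; exact hnL.trans hns
      have h7 := abs_sub_abs_le_abs_sub (kernelDeviation P q K b x v)
        (kernelDeviation P q K b x (k / n ^ 2))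
      have h8 := hgrid k hkI
      linarith
  calc (Measure.pi fun _ : Fin n => P).real _
      ≤ (Measure.pi fun _ : Fin n => P).real
        (⋃ k ∈ I, {x | (S + 7) * s ≤ |kernelDeviation P q K b x ((k : ℝ) / n ^ 2)|}) :=
        ENNReal.toReal_mono (measure_ne_top _ _) (measure_mono_ae hincl)
    _ ≤ ∑ k ∈ I, (Measure.pi fun _ : Fin n => P).real
        {x | (S + 7) * s ≤ |kernelDeviation P q K b x ((k : ℝ) / n ^ 2)|} :=
        measureReal_biUnion_finset_le _ _
    _ ≤ ∑ k ∈ I, 2 / (n : ℝ) ^ 7 := Finset.sum_le_sum fun k _ =>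
        real_le_abs_kernelDeviation_le hK hB hb hq (hS _) hn1 hsmall
    _ ≤ 2 / (n : ℝ) ^ 2 := by
        rw [Finset.sum_const, nsmul_eq_mul]
        calc (I.card : ℝ) * (2 / (n : ℝ) ^ 7) ≤ (n : ℝ) ^ 5 * (2 / (n : ℝ) ^ 7) := by gcongr
          _ = 2 / (n : ℝ) ^ 2 := by field_simp

end

/-! ### Uniform consistency of the kernel estimator -/

/-- The second moment of a rescaled kernel under a law with bounded density. -/
theorem integral_rescaledKernel_sq_le {K : ℝ → ℝ} (hK : IsSmoothingKernel K) {B : ℝ}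
    (hB : ∀ u, |K u| ≤ B) {g : ℝ → ℝ} (hg0 : ∀ v, 0 ≤ g v) {G : ℝ}
    (hG : ∀ v, |g v| ≤ G) {b : ℝ} (hb : 0 < b) (v : ℝ) :
    ∫ y, rescaledKernel K b v y ^ 2 * g y ≤ (B * G * ∫ u, |K u|) / b := by
  have hB0 : 0 ≤ B := (abs_nonneg _).trans (hB 0)
  have hG0 : 0 ≤ G := (abs_nonneg _).trans (hG 0)
  have e : ∀ y, rescaledKernel K b v y ^ 2 * g y =
      1 / b * (1 / b * ((fun u => K u ^ 2) ((v - y) / b)) * g y) := fun y => by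
    rw [rescaledKernel]; ring
  simp_rw [e]
  rw [integral_const_mul, integral_rescale hb v (fun u => K u ^ 2) g, one_div_mul_eq_div]
  gcongr
  rw [← integral_const_mul]
  refine integral_mono_of_nonneg (ae_of_all _ fun u => mul_nonneg (sq_nonneg _) (hg0 _))
    (hK.integrable.abs.const_mul _) (ae_of_all _ fun u => ?_)
  simp only
  calc K u ^ 2 * g (v - b * u) = |K u| * |K u| * g (v - b * u) := by rw [← sq, sq_abs]
    _ ≤ B * |K u| * G := by
        gcongr
        · exact hg0 _
        · exact hB u
        · exact (le_abs_self _).trans (hG _)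
    _ = B * G * |K u| := by ring

instance isProbabilityMeasure_sampleLaw {D : ℕ} (P : Measure (Ambient D)) [IsProbabilityMeasure P]
    (n : ℕ) : IsProbabilityMeasure (sampleLaw P n) := by
  unfold sampleLaw; infer_instance

/-- The deterministic part of the error bound for the kernel estimator. -/
theorem abs_gHat_sub_le_of_kernelDeviation {D n d : ℕ} (hn : 0 < n) {M : Set (Ambient D)}
    {P : Measure (Ambient D)} [IsProbabilityMeasure P] {ρ t₁ C R : ℝ}
    (h : UniformDensity d M P ρ t₁ C R) (hPM : P Mᶜ = 0) {g : ℝ → ℝ} (hg : IsShellDensity d P g)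
    (hq : AEMeasurable (localDensity d P) P) {K : ℝ → ℝ} (hK : IsSmoothingKernel K)
    (hgd : Differentiable ℝ g) {L : ℝ≥0} (hL : LipschitzWith L (deriv g)) {L' : ℝ≥0}
    (hL' : LipschitzWith L' K) {b : ℝ} (hb : 0 < b) {x : Fin n → Ambient D} {η s : ℝ}
    (hη : ∀ i, |shellValue d x i - localDensity d P (x i)| ≤ η) {v : ℝ}
    (hs : |kernelDeviation P (localDensity d P) K b x v| ≤ s) :
    |gHat d K b x v - g v| ≤ (L * ∫ u, u ^ 2 * |K u|) * b ^ 2 + s + L' * η / b ^ 2 := by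
  obtain ⟨G, -, hG⟩ := hg.exists_bound h hPM hq hgd.continuous
  have h1 := abs_gHat_sub_le hn hL' hb x (fun i => localDensity d P (x i)) hη v
  have h2 := hK.abs_integral_sub_le hgd hL hG hb v
  have h3 : ∫ y, rescaledKernel K b v (localDensity d P y) ∂P =
      ∫ y, (1 / b) * K ((v - y) / b) * g y :=
    hg.integral_comp_localDensity hq (continuous_rescaledKernel hK.continuous b v).measurable
  have e : gHat d K b x v - g v =
      (gHat d K b x v - 1 / n * ∑ i, 1 / b * K ((v - localDensity d P (x i)) / b)) +
      kernelDeviation P (localDensity d P) K b x v +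
      ((∫ y, (1 / b) * K ((v - y) / b) * g y) - g v) := by
    rw [kernelDeviation, h3]; simp only [rescaledKernel]; ring
  rw [e]
  refine (abs_add_three _ _ _).trans ?_
  linarith

/-- Nonasymptotic form of the uniform consistency of the kernel estimator. -/
theorem exists_forall_real_not_abs_gHat_sub_le {D d : ℕ} {M : Set (Ambient D)}
    {P : Measure (Ambient D)} [IsProbabilityMeasure P] {ρ t₁ C R : ℝ}
    (h : UniformDensity d M P ρ t₁ C R) (hM : MeasurableSet M) (hPM : P Mᶜ = 0) {g : ℝ → ℝ}
    (hg : IsShellDensity d P g) {K : ℝ → ℝ} (hK : IsSmoothingKernel K)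
    (hgd : Differentiable ℝ g) {L : ℝ≥0} (hL : LipschitzWith L (deriv g)) :
    ∃ C C' A : ℝ, 0 ≤ C ∧ 0 ≤ C' ∧ 0 ≤ A ∧ ∃ N : ℕ, ∀ n ≥ N, ∀ b > (0 : ℝ),
      (sampleLaw P n).real {x | ¬ ∀ v : ℝ, |gHat d K b x v - g v| ≤
        C * b ^ 2 + A * √(Real.log n / (n * b)) + C' * (rate d n / b ^ 2)} ≤ 4 / n ^ 2 := by
  have hq := h.aemeasurable_localDensity hM hPM
  obtain ⟨G, hG0, hG⟩ := hg.exists_bound h hPM hq hgd.continuous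
  obtain ⟨B, hB0, hB, hB'⟩ := hK.exists_bound
  obtain ⟨L', hL'⟩ := hK.lipschitz
  have hR0 : 0 < R := h.rho_pos.trans_le h.rho_le
  have hMae : ∀ᵐ y ∂P, y ∈ M := by rw [ae_iff]; exact hPM
  have hqR : ∀ᵐ y ∂P, |localDensity d P y| ≤ R := by
    filter_upwards [hMae] with y hy
    rw [abs_of_nonneg (h.rho_pos.le.trans (h.lower_le y hy))]
    exact h.le_upper y hy
  set J := ∫ u, u ^ 2 * |K u| with hJ
  have hJ0 : 0 ≤ J := integral_nonneg fun u => by positivity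
  set S := B * G * ∫ u, |K u| with hS
  have hS0 : 0 ≤ S := mul_nonneg (by positivity) (integral_nonneg fun u => abs_nonneg _)
  have hS' : ∀ b > 0, ∀ v, ∫ y, rescaledKernel K b v (localDensity d P y) ^ 2 ∂P ≤ S / b := by
    intro b hb v
    rw [hg.integral_comp_localDensity hq (f := fun y => rescaledKernel K b v y ^ 2)
      ((continuous_rescaledKernel hK.continuous b v).measurable.pow_const 2)]
    exact integral_rescaledKernel_sq_le hK hB hg.nonneg hG hb v
  set C₃ := C + 2 * R + 4 with hC₃
  have hC₃0 : 0 ≤ C₃ := by have := h.const_nonneg; positivity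
  -- L J is the bias constant and L' C₃ the cost of replacing V_i by q(X_i). The extra B + G absorbs
  -- the crude bound |ĝ - g| ≤ B/b + G, into the b² term when b ≥ 1 and into the r / b² term when b
  -- ≤ r.
  refine ⟨L * J + B + G, L' * C₃ + B + G, S + 8, by positivity, by positivity, by positivity, ?_⟩
  have hsqrt : Tendsto (fun n : ℕ => √(n : ℝ)) atTop atTop :=
    Real.tendsto_sqrt_atTop.comp tendsto_natCast_atTop_atTop
  have hev : ∀ᶠ n : ℕ in atTop, 3 ≤ n ∧ rate d n < min t₁ (min (1 / 2) ((1 / (2 * B)) ^ 2)) ∧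
      R ≤ n ∧ 2 * L' ≤ √(n : ℝ) ∧ 2 * B ≤ √(n : ℝ) := by
    refine (eventually_ge_atTop 3).and (((tendsto_rate d).eventually_lt_const
      (lt_min h.scale_pos (lt_min (by norm_num) (by positivity)))).and
      ((tendsto_natCast_atTop_atTop.eventually_ge_atTop R).and
      ((hsqrt.eventually_ge_atTop _).and (hsqrt.eventually_ge_atTop _))))
  obtain ⟨N, hN⟩ := eventually_atTop.1 hev
  refine ⟨N, fun n hn b hb => ?_⟩
  obtain ⟨hn3, hr, hnR, hnL, hnB⟩ := hN n hn
  have hrt := hr.trans_le (min_le_left _ _)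
  have hr' := hr.trans_le (min_le_right _ _)
  have hr2 := hr'.trans_le (min_le_left _ _)
  have hr3 := hr'.trans_le (min_le_right _ _)
  have hr0 : 0 < rate d n := rate_pos (by omega)
  have hn0 : (0 : ℝ) < n := by positivity
  have hlog := one_le_log_natCast hn3
  have hcrude : ∀ (x : Fin n → Ambient D) (v : ℝ), |gHat d K b x v - g v| ≤ B / b + G := fun x v =>
    (abs_sub _ _).trans (add_le_add (abs_average_le (show 0 < n by omega) fun i =>
      abs_rescaledKernel_le hB hb v (shellValue d x i)) (hG v))
  set s := √(Real.log n / (n * b)) with hs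
  have hs0 : 0 ≤ s := Real.sqrt_nonneg _
  have htriv : (∀ v : ℝ, ∀ x : Fin n → Ambient D, |gHat d K b x v - g v| ≤
        (L * J + B + G) * b ^ 2 + (S + 8) * s + (L' * C₃ + B + G) * (rate d n / b ^ 2)) →
      (sampleLaw P n).real {x | ¬ ∀ v : ℝ, |gHat d K b x v - g v| ≤
        (L * J + B + G) * b ^ 2 + (S + 8) * s + (L' * C₃ + B + G) * (rate d n / b ^ 2)} ≤
        4 / n ^ 2 := by
    intro H
    have : {x : Fin n → Ambient D | ¬ ∀ v : ℝ, |gHat d K b x v - g v| ≤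
        (L * J + B + G) * b ^ 2 + (S + 8) * s + (L' * C₃ + B + G) * (rate d n / b ^ 2)} = ∅ :=
      eq_empty_of_forall_notMem fun x hx => hx fun v => H v x
    rw [this, measureReal_empty]; positivity
  rcases le_total 1 b with hb1 | hb1
  · refine htriv fun v x => (hcrude x v).trans ?_
    have h1 : B / b ≤ B := div_le_self hB0.le hb1
    have h2 : 1 ≤ b ^ 2 := one_le_pow₀ hb1
    have h3 : B + G ≤ (L * J + B + G) * b ^ 2 := by
      calc B + G ≤ (L * J + B + G) * 1 := by
            have : 0 ≤ (L : ℝ) * J := by positivity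
            linarith
        _ ≤ _ := by gcongr
    have h4 : 0 ≤ (S + 8) * s := by positivity
    have h5 : 0 ≤ (L' * C₃ + B + G) * (rate d n / b ^ 2) := by positivity
    linarith
  rcases le_total b (rate d n) with hbr | hbr
  · refine htriv fun v x => (hcrude x v).trans ?_
    have h1 : 1 / b ≤ rate d n / b ^ 2 := by
      rw [div_le_div_iff₀ hb (by positivity)]
      nlinarith
    have h2 : 1 ≤ 1 / b := by rw [le_div_iff₀ hb]; linarith
    have h3 : B / b + G ≤ (L' * C₃ + B + G) * (rate d n / b ^ 2) := by
      calc B / b + G ≤ (B + G) * (1 / b) := by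
            have : G * 1 ≤ G * (1 / b) := by gcongr
            rw [div_eq_mul_one_div]; linarith
        _ ≤ (L' * C₃ + B + G) * (rate d n / b ^ 2) := by
            gcongr
            have : 0 ≤ (L' : ℝ) * C₃ := by positivity
            linarith
    have h4 : 0 ≤ (S + 8) * s := by positivity
    have h5 : 0 ≤ (L * J + B + G) * b ^ 2 := by positivity
    linarith
  -- Now r ≤ b ≤ 1, so log n / (n b) = r^(d+2) / b ≤ r, which is small; this is the range in which
  -- Bernstein's inequality gives a Gaussian-type tail.
  have hsr : s ≤ 1 / (2 * B) := by
    refine Real.sqrt_le_iff.2 ⟨by positivity, ?_⟩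
    refine le_trans ?_ hr3.le
    rw [div_le_iff₀ (by positivity), ← natCast_mul_rate_pow (d := d) (by omega : 1 ≤ n)]
    calc n * rate d n ^ (d + 2) = rate d n * (n * rate d n) * rate d n ^ d := by ring
      _ ≤ rate d n * (n * b) * 1 := by
          gcongr
          exact pow_le_one₀ hr0.le (by linarith)
      _ = _ := mul_one _
  have hsmall : s * (2 * B) ≤ 1 := by
    rwa [le_div_iff₀ (by positivity)] at hsr
  have hnb : 1 ≤ n * b ^ 2 := by
    calc 1 ≤ Real.log n := hlog
      _ = n * rate d n ^ 2 * rate d n ^ d := by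
          rw [← natCast_mul_rate_pow (d := d) (by omega : 1 ≤ n)]; ring
      _ ≤ n * b ^ 2 * 1 := by
          gcongr
          exact pow_le_one₀ hr0.le (by linarith)
      _ = _ := mul_one _
  have p1 := h.real_shellValue_sub_le hPM hn3 hrt.le hr2.le
  have p2 := real_not_abs_kernelDeviation_le hK.continuous hB hB' hL' hb hb1 hq hqR (hS' b hb) hn3
    hsmall hnR hnb hnL hnB
  change (sampleLaw P n).real _ ≤ _ at p2
  have hsub : {x : Fin n → Ambient D | ¬ ∀ v : ℝ, |gHat d K b x v - g v| ≤
      (L * J + B + G) * b ^ 2 + (S + 8) * s + (L' * C₃ + B + G) * (rate d n / b ^ 2)} ⊆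
      {x | ¬ ∀ i, |shellValue d x i - localDensity d P (x i)| ≤ C₃ * rate d n} ∪
      {x | ¬ ∀ v, |kernelDeviation P (localDensity d P) K b x v| ≤ (S + 8) * s} := by
    intro x hx
    by_contra hnot
    simp only [mem_union, mem_ofPred_eq, not_or, not_not] at hnot
    refine hx fun v => ?_
    refine (abs_gHat_sub_le_of_kernelDeviation (by omega) h hPM hg hq hK hgd hL hL' hb hnot.1
      (hnot.2 v)).trans ?_
    have h1 : (L * J) * b ^ 2 ≤ (L * J + B + G) * b ^ 2 := by gcongr; linarith
    have h2 : L' * (C₃ * rate d n) / b ^ 2 ≤ (L' * C₃ + B + G) * (rate d n / b ^ 2) := by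
      rw [← mul_assoc, mul_div_assoc]; gcongr; linarith
    linarith
  calc _ ≤ _ := measureReal_mono hsub (measure_ne_top _ _)
    _ ≤ _ := measureReal_union_le _ _
    _ ≤ 2 / (n : ℝ) ^ 2 + 2 / (n : ℝ) ^ 2 := add_le_add p1 p2
    _ = 4 / (n : ℝ) ^ 2 := by ring

theorem exists_forall_four_div_sq_le {ε : ℝ} (hε : 0 < ε) :
    ∃ N : ℕ, ∀ n ≥ N, 4 / (n : ℝ) ^ 2 ≤ ε := by
  have h1 : Tendsto (fun n : ℕ => 4 / (n : ℝ) ^ 2) atTop (𝓝 0) :=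
    ((tendsto_pow_atTop (by norm_num)).comp tendsto_natCast_atTop_atTop).const_div_atTop 4
  obtain ⟨N, hN⟩ := eventually_atTop.1 (h1.eventually_le_const hε)
  exact ⟨N, hN⟩

/-- For bandwidths of order `rate d n ^ (1 / 4)`, the three error terms are `O(√(rate d n))`. -/
theorem exists_error_le_sqrt_rate {d : ℕ} {C C' A : ℝ} (hC : 0 ≤ C) (hC' : 0 ≤ C')
    (hA : 0 ≤ A) {b : ℕ → ℝ} (hb : ∀ n, 0 < b n)
    (hbr : b =Θ[atTop] fun n => rate d n ^ (1 / 4 : ℝ)) :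
    ∃ A' : ℝ, ∃ N : ℕ, ∀ n ≥ N,
      C * b n ^ 2 + A * √(Real.log n / (n * b n)) + C' * (rate d n / b n ^ 2) ≤
        A' * √(rate d n) := by
  obtain ⟨c₁, hc₁, h1⟩ := hbr.1.exists_pos
  obtain ⟨c₂, hc₂, h2⟩ := hbr.2.exists_pos
  refine ⟨C * c₁ ^ 2 + A * √c₂ + C' * c₂ ^ 2, ?_⟩
  refine eventually_atTop.1 ?_
  filter_upwards [h1.bound, h2.bound, eventually_ge_atTop 3,
    (tendsto_rate d).eventually_lt_const one_pos] with n h1 h2 hn hr1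
  have hr0 : 0 < rate d n := rate_pos (by omega)
  have hn0 : (0 : ℝ) < n := by positivity
  set r := rate d n with hr
  -- As b is of order w, both b² and r / b² are of order w² = √r, while log n / (n b) = r^(d+2) / b
  -- is at most a multiple of r.
  set w := r ^ (1 / 4 : ℝ) with hw
  have hw0 : 0 < w := Real.rpow_pos_of_pos hr0 _
  have hw2 : w ^ 2 = √r := by
    rw [hw, ← Real.rpow_natCast, ← Real.rpow_mul hr0.le, Real.sqrt_eq_rpow]; norm_num
  have hw4 : w ^ 4 = r := by
    rw [show 4 = 2 * 2 by norm_num, pow_mul, hw2, Real.sq_sqrt hr0.le]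
  have hw1 : w ≤ 1 := Real.rpow_le_one hr0.le hr1.le (by norm_num)
  rw [Real.norm_eq_abs, Real.norm_eq_abs, abs_of_pos (hb n), abs_of_pos hw0] at h1 h2
  have hbn := hb n
  have e1 : C * b n ^ 2 ≤ C * c₁ ^ 2 * √r := by
    rw [← hw2]
    calc C * b n ^ 2 ≤ C * (c₁ * w) ^ 2 := by gcongr
      _ = _ := by ring
  have e2 : A * √(Real.log n / (n * b n)) ≤ A * √c₂ * √r := by
    rw [mul_assoc, ← Real.sqrt_mul hc₂.le]
    gcongr
    rw [div_le_iff₀ (by positivity), ← natCast_mul_rate_pow (d := d) (by omega : 1 ≤ n)]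
    calc n * r ^ (d + 2) = n * r * (r ^ d * r) := by ring
      _ ≤ n * r * (1 * w) := by
          gcongr
          · exact pow_le_one₀ hr0.le hr1.le
          · rw [← hw4]
            calc w ^ 4 = w * w ^ 3 := by ring
              _ ≤ w * 1 := by gcongr; exact pow_le_one₀ hw0.le hw1
              _ = w := mul_one w
      _ ≤ n * r * (1 * (c₂ * b n)) := by gcongr
      _ = _ := by ring
  have e3 : C' * (r / b n ^ 2) ≤ C' * c₂ ^ 2 * √r := by
    rw [mul_assoc]
    gcongr
    rw [div_le_iff₀ (by positivity), ← hw2]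
    calc r = w ^ 2 * w ^ 2 := by rw [← hw4]; ring
      _ ≤ w ^ 2 * (c₂ * b n) ^ 2 := by gcongr
      _ = _ := by ring
  calc _ ≤ C * c₁ ^ 2 * √r + A * √c₂ * √r + C' * c₂ ^ 2 * √r := by linarith
    _ = _ := by ring

/-! ### Laplace-type integrals and the shells equation -/

noncomputable section

/-- The Laplace-type integral `∫_l^∞ (w(v) / v) e^{-s v} dv`. -/
def laplaceTail (w : ℝ → ℝ) (l s : ℝ) : ℝ := ∫ v in Ioi l, w v / v * Real.exp (-(s * v))

end

section

variable {w : ℝ → ℝ} {l : ℝ}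

theorem integrableOn_laplaceTail (hl : 0 < l) (hwi : IntegrableOn w (Ioi l)) {s : ℝ} (hs : 0 ≤ s) :
    IntegrableOn (fun v => w v / v * Real.exp (-(s * v))) (Ioi l) := by
  have e : (fun v => w v / v * Real.exp (-(s * v))) =
      fun v => w v * (v⁻¹ * Real.exp (-(s * v))) := by
    ext v; rw [div_eq_mul_inv, mul_assoc]
  rw [e]
  refine Integrable.mul_bdd (c := l⁻¹) hwi (by fun_prop) ?_
  filter_upwards [ae_restrict_mem measurableSet_Ioi] with v hv
  have hv : l < v := hv
  have hv0 : 0 < v := hl.trans hv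
  rw [Real.norm_eq_abs, abs_of_pos (by positivity)]
  calc v⁻¹ * Real.exp (-(s * v)) ≤ l⁻¹ * 1 := by
        gcongr
        rw [Real.exp_le_one_iff]
        have := mul_nonneg hs hv0.le
        linarith
    _ = l⁻¹ := mul_one _

theorem laplaceTail_anti (hl : 0 < l) (hw : ∀ v, 0 ≤ w v) (hwi : IntegrableOn w (Ioi l)) {s s' : ℝ}
    (hs : 0 ≤ s) (hss : s ≤ s') : laplaceTail w l s' ≤ laplaceTail w l s := by
  refine setIntegral_mono_on (integrableOn_laplaceTail hl hwi (hs.trans hss))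
    (integrableOn_laplaceTail hl hwi hs) measurableSet_Ioi fun v hv => ?_
  have hv0 : 0 < v := hl.trans hv
  have := hw v
  gcongr

theorem laplaceTail_pos (hl : 0 < l) (hw : ∀ v, 0 ≤ w v) (hwi : IntegrableOn w (Ioi l))
    (hpos : 0 < ∫ v in Ioi l, w v) {s : ℝ} (hs : 0 ≤ s) : 0 < laplaceTail w l s := by
  have hnn : 0 ≤ᵐ[volume.restrict (Ioi l)] fun v => w v / v * Real.exp (-(s * v)) := by
    filter_upwards [ae_restrict_mem measurableSet_Ioi] with v hv
    have hv0 : 0 < v := hl.trans hv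
    have := hw v
    positivity
  refine (setIntegral_nonneg_of_ae_restrict hnn).lt_of_ne' fun h0 => hpos.ne' ?_
  rw [setIntegral_eq_zero_iff_of_nonneg_ae hnn (integrableOn_laplaceTail hl hwi hs)] at h0
  refine integral_eq_zero_of_ae ?_
  filter_upwards [h0, ae_restrict_mem measurableSet_Ioi] with v hv0 hv
  have hv1 : 0 < v := hl.trans hv
  simpa [hv1.ne', (Real.exp_pos _).ne'] using hv0

theorem continuousOn_laplaceTail (hl : 0 < l) (hw : ∀ v, 0 ≤ w v) (hwi : IntegrableOn w (Ioi l)) :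
    ContinuousOn (laplaceTail w l) (Ici 0) := by
  have h0 := integrableOn_laplaceTail hl hwi le_rfl
  refine continuousOn_of_dominated
    (bound := fun v => w v / v * Real.exp (-(0 * v)))
    (fun s hs => (integrableOn_laplaceTail hl hwi hs).aestronglyMeasurable) ?_ h0 ?_
  · intro s hs
    filter_upwards [ae_restrict_mem measurableSet_Ioi] with v hv
    have hv0 : 0 < v := hl.trans hv
    have := hw v
    have hs : 0 ≤ s := hs
    rw [Real.norm_eq_abs, abs_of_nonneg (by positivity)]
    gcongr
  · exact ae_of_all _ fun v => Continuous.continuousOn (by fun_prop)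

theorem strictAntiOn_laplaceTail_pow (hl : 0 < l) (hw : ∀ v, 0 ≤ w v)
    (hwi : IntegrableOn w (Ioi l)) (hpos : 0 < ∫ v in Ioi l, w v) {c κ : ℝ} (hc : 0 < c)
    (hκ : 0 ≤ κ) {d : ℕ} (hd : 0 < d) :
    StrictAntiOn (fun t => c / t ^ d * laplaceTail w l (κ * t ^ d)) (Ioi 0) := by
  intro t ht t' ht' htt
  have ht : 0 < t := ht
  have ht' : 0 < t' := ht'
  have h1 : t ^ d < t' ^ d := pow_lt_pow_left₀ htt ht.le hd.ne'
  have h2 := laplaceTail_anti hl hw hwi (s := κ * t ^ d) (s' := κ * t' ^ d) (by positivity)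
    (by gcongr)
  have h3 := laplaceTail_pos hl hw hwi hpos (s := κ * t ^ d) (by positivity)
  have h4 := laplaceTail_pos hl hw hwi hpos (s := κ * t' ^ d) (by positivity)
  have h5 : c / t' ^ d < c / t ^ d := div_lt_div_of_pos_left hc (by positivity) h1
  exact mul_lt_mul h5 h2 h4 (by positivity)

/-- A strictly decreasing factor c / t^d times a positive nonincreasing one gives uniqueness; the
intermediate value theorem gives existence. -/
theorem existsUnique_laplaceTail_pow_eq (hl : 0 < l) (hw : ∀ v, 0 ≤ w v)
    (hwi : IntegrableOn w (Ioi l)) (hpos : 0 < ∫ v in Ioi l, w v) {c κ α : ℝ} (hc : 0 < c)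
    (hκ : 0 ≤ κ) (hα : 0 < α) {d : ℕ} (hd : 0 < d) :
    ∃! t, 0 < t ∧ c / t ^ d * laplaceTail w l (κ * t ^ d) = α := by
  have hJ0 := laplaceTail_pos hl hw hwi hpos le_rfl
  have hJ1 := laplaceTail_pos hl hw hwi hpos hκ
  -- Since ta ≤ 1 ≤ tb, one may compare t^d with t and bound the tail by its value at κ,
  -- respectively 0; the second entries then put the function on either side of α.
  set ta := min 1 (c * laplaceTail w l κ / α) with hta
  set tb := max 1 (c * laplaceTail w l 0 / α) with htb
  have hta0 : 0 < ta := lt_min one_pos (by positivity)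
  have htab : ta ≤ tb := (min_le_left _ _).trans (le_max_left _ _)
  have hcont : ContinuousOn (fun t => c / t ^ d * laplaceTail w l (κ * t ^ d)) (Icc ta tb) := by
    have hne : ∀ t ∈ Icc ta tb, t ^ d ≠ 0 := fun t ht => (pow_pos (hta0.trans_le ht.1) d).ne'
    refine (continuousOn_const.div (by fun_prop) hne).mul
      ((continuousOn_laplaceTail hl hw hwi).comp (by fun_prop) fun t ht => ?_)
    have := (pow_pos (hta0.trans_le ht.1) d).le
    exact mul_nonneg hκ this
  have ha : α ≤ c / ta ^ d * laplaceTail w l (κ * ta ^ d) := by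
    have h1 : ta ^ d ≤ ta := pow_le_of_le_one hta0.le (min_le_left _ _) hd.ne'
    have h2 : ta ^ d ≤ 1 := pow_le_one₀ hta0.le (min_le_left _ _)
    have h3 : laplaceTail w l κ ≤ laplaceTail w l (κ * ta ^ d) :=
      laplaceTail_anti hl hw hwi (by positivity) (mul_le_of_le_one_right hκ h2)
    calc α ≤ c / ta * laplaceTail w l κ := by
          rw [div_mul_eq_mul_div, le_div_iff₀ hta0]
          calc α * ta ≤ α * (c * laplaceTail w l κ / α) := by gcongr; exact min_le_right _ _
            _ = c * laplaceTail w l κ := by field_simp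
      _ ≤ c / ta ^ d * laplaceTail w l (κ * ta ^ d) := by gcongr
  have hb : c / tb ^ d * laplaceTail w l (κ * tb ^ d) ≤ α := by
    have htb1 : 1 ≤ tb := le_max_left _ _
    have htb0 : 0 < tb := one_pos.trans_le htb1
    have h1 : tb ≤ tb ^ d := le_self_pow₀ htb1 hd.ne'
    have h3 : laplaceTail w l (κ * tb ^ d) ≤ laplaceTail w l 0 :=
      laplaceTail_anti hl hw hwi le_rfl (by positivity)
    have h4 := laplaceTail_pos hl hw hwi hpos (s := κ * tb ^ d) (by positivity)
    calc c / tb ^ d * laplaceTail w l (κ * tb ^ d) ≤ c / tb * laplaceTail w l 0 := by gcongr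
      _ ≤ α := by
          rw [div_mul_eq_mul_div, div_le_iff₀ htb0]
          calc c * laplaceTail w l 0 = α * (c * laplaceTail w l 0 / α) := by field_simp
            _ ≤ α * tb := by gcongr; exact le_max_right _ _
  obtain ⟨t, ht, hte⟩ := intermediate_value_Icc' htab hcont ⟨hb, ha⟩
  have ht0 : 0 < t := hta0.trans_le ht.1
  refine ⟨t, ⟨ht0, hte⟩, fun t' ht' => ?_⟩
  exact (strictAntiOn_laplaceTail_pow hl hw hwi hpos hc hκ hd).injOn ht'.1 ht0
    (ht'.2.trans hte.symm)

end

section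

variable {D n d : ℕ} {K : ℝ → ℝ} {b l α : ℝ} {x : Fin n → Ambient D}

theorem shellBound_eq_laplaceTail (t : ℝ) :
    shellBound d K b l x t =
      2 ^ (d + 1) / t ^ d * laplaceTail (gHat d K b x) l ((n : ℝ) / 2 * t ^ d) := by
  rw [shellBound, laplaceTail]
  congr 2
  ext v
  congr 3
  ring

theorem gHat_nonneg (hK0 : ∀ u, 0 ≤ K u) (hb : 0 < b) (v : ℝ) : 0 ≤ gHat d K b x v :=
  mul_nonneg (by positivity) (Finset.sum_nonneg fun i _ => mul_nonneg (by positivity) (hK0 _))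

theorem IsSmoothingKernel.integrable_rescale (hK : IsSmoothingKernel K) (hb : 0 < b) (a : ℝ) :
    Integrable fun v => 1 / b * K ((v - a) / b) :=
  ((hK.integrable.comp_div hb.ne').comp_sub_right a).const_mul _

theorem IsSmoothingKernel.integrable_gHat (hK : IsSmoothingKernel K) (hb : 0 < b) :
    Integrable (gHat d K b x) := by
  unfold gHat
  exact (integrable_finsetSum _ fun i _ => hK.integrable_rescale hb _).const_mul _

theorem IsSmoothingKernel.setIntegral_Ioi_zero (hK : IsSmoothingKernel K) :
    ∫ u in Ioi 0, K u = 1 / 2 := by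
  have h1 := integral_comp_neg_Iic (0 : ℝ) K
  simp only [hK.symmetric, neg_zero] at h1
  have h2 := intervalIntegral.integral_Iic_add_Ioi (b := (0 : ℝ)) hK.integrable.integrableOn
    hK.integrable.integrableOn
  rw [hK.integral_eq_one, h1] at h2
  linarith

theorem setIntegral_rescale_Ioc (hb : 0 < b) {a e : ℝ} (hae : a ≤ e) :
    ∫ v in Ioc a e, 1 / b * K ((v - a) / b) = ∫ u in Ioc 0 ((e - a) / b), K u := by
  rw [← intervalIntegral.integral_of_le hae, ← intervalIntegral.integral_of_le
    (div_nonneg (by linarith) hb.le), intervalIntegral.integral_const_mul]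
  have h := intervalIntegral.integral_comp_div_sub (a := a) (b := e) K hb.ne' (a / b)
  simp only [← sub_div, sub_self, smul_eq_mul] at h
  rw [h]; field_simp

/-- The mass of the kernel estimator on an interval, in terms of the sample points well inside. -/
theorem le_setIntegral_gHat (hK : IsSmoothingKernel K) (hK0 : ∀ u, 0 ≤ K u) (hb : 0 < b)
    {β ζ : ℝ} (hζ : 0 ≤ ζ) (I : Finset (Fin n))
    (hI : ∀ i ∈ I, l ≤ shellValue d x i ∧ shellValue d x i ≤ β - ζ) :
    (I.card : ℝ) / n * ∫ u in Ioc 0 (ζ / b), K u ≤ ∫ v in Ioc l β, gHat d K b x v := by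
  have hint : ∀ a, IntegrableOn (fun v => 1 / b * K ((v - a) / b)) (Ioc l β) := fun a =>
    (hK.integrable_rescale hb a).integrableOn
  have hnn : ∀ a v, 0 ≤ 1 / b * K ((v - a) / b) := fun a v => mul_nonneg (by positivity) (hK0 _)
  simp only [gHat]
  rw [integral_const_mul, integral_finsetSum _ fun i _ => hint _, div_mul_eq_mul_div,
    one_div_mul_eq_div]
  gcongr
  calc (I.card : ℝ) * ∫ u in Ioc 0 (ζ / b), K u = ∑ _i ∈ I, ∫ u in Ioc 0 (ζ / b), K u := by
        rw [Finset.sum_const, nsmul_eq_mul]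
    _ ≤ ∑ i ∈ I, ∫ v in Ioc l β, 1 / b * K ((v - shellValue d x i) / b) := by
        refine Finset.sum_le_sum fun i hi => ?_
        obtain ⟨h1, h2⟩ := hI i hi
        set a := shellValue d x i with ha
        have h3 : ∫ v in Ioc a (a + ζ), 1 / b * K ((v - a) / b) = ∫ u in Ioc 0 (ζ / b), K u := by
          rw [setIntegral_rescale_Ioc hb (by linarith), add_sub_cancel_left]
        rw [← h3]
        exact setIntegral_mono_set (hint a) (ae_of_all _ fun v => hnn a v)
          (Ioc_subset_Ioc h1 (by linarith)).eventuallyLE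
    _ ≤ ∑ i, ∫ v in Ioc l β, 1 / b * K ((v - shellValue d x i) / b) :=
        Finset.sum_le_univ_sum_of_nonneg fun i => integral_nonneg fun v => hnn _ v

/-- Half of the mass of the kernel centred at V_i lies to its right, so V_i = l is allowed. This is
the case when l is the minimum of the shell values. -/
theorem setIntegral_gHat_pos (hK : IsSmoothingKernel K) (hK0 : ∀ u, 0 ≤ K u) (hb : 0 < b)
    (i : Fin n) (hi : l ≤ shellValue d x i) : 0 < ∫ v in Ioi l, gHat d K b x v := by
  have hn : (0 : ℝ) < n := by exact_mod_cast i.pos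
  have ht : Tendsto (fun R => ∫ u in (0 : ℝ)..R, K u) atTop (𝓝 (∫ u in Ioi 0, K u)) :=
    intervalIntegral_tendsto_integral_Ioi 0 hK.integrable.integrableOn tendsto_id
  rw [hK.setIntegral_Ioi_zero] at ht
  obtain ⟨R, hR, hR0⟩ := ((ht.eventually_const_lt (show (0 : ℝ) < 1 / 2 by norm_num)).and
    (eventually_ge_atTop 0)).exists
  rw [intervalIntegral.integral_of_le hR0] at hR
  have h1 := le_setIntegral_gHat hK hK0 hb (d := d) (x := x) (l := l)
    (β := shellValue d x i + R * b) (ζ := R * b) (by positivity) {i} (by simpa using hi)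
  rw [mul_div_cancel_right₀ _ hb.ne', Finset.card_singleton] at h1
  have h2 : ∫ v in Ioc l (shellValue d x i + R * b), gHat d K b x v ≤
      ∫ v in Ioi l, gHat d K b x v :=
    setIntegral_mono_set (hK.integrable_gHat hb).integrableOn
      (ae_of_all _ fun v => gHat_nonneg hK0 hb v) Ioc_subset_Ioi_self.eventuallyLE
  refine lt_of_lt_of_le ?_ (h1.trans h2)
  push_cast
  positivity

theorem existsUnique_solvesShell (hd : 0 < d) (hK : IsSmoothingKernel K) (hK0 : ∀ u, 0 ≤ K u)
    (hα : 0 < α) (hb : 0 < b) (hl : 0 < l) (i : Fin n) (hi : l ≤ shellValue d x i) :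
    ∃! t, SolvesShell d K α b l x t := by
  simp only [SolvesShell, shellBound_eq_laplaceTail]
  exact existsUnique_laplaceTail_pow_eq hl (gHat_nonneg hK0 hb) (hK.integrable_gHat hb).integrableOn
    (setIntegral_gHat_pos hK hK0 hb i hi) (by positivity) (by positivity) hα hd

theorem tHat_eq {t : ℝ} (ht : SolvesShell d K α b l x t)
    (hu : ∃! t, SolvesShell d K α b l x t) : tHat d K α b l x = t := by
  have : {t | SolvesShell d K α b l x t} = {t} := by
    ext t'
    exact ⟨fun h => hu.unique h ht, fun h => by rw [mem_singleton_iff.1 h]; exact ht⟩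
  rw [tHat, this, csInf_singleton]

/-- A radius at which the shells bound exceeds `α` is at most the solution of the equation. -/
theorem le_tHat_of_le_shellBound (hd : 0 < d) (hK : IsSmoothingKernel K) (hK0 : ∀ u, 0 ≤ K u)
    (hα : 0 < α) (hb : 0 < b) (hl : 0 < l) (i : Fin n) (hi : l ≤ shellValue d x i) {t : ℝ}
    (ht : 0 < t) (hαt : α ≤ shellBound d K b l x t) : t ≤ tHat d K α b l x := by
  have hu := existsUnique_solvesShell (α := α) hd hK hK0 hα hb hl i hi
  obtain ⟨s, hs⟩ := hu.exists
  rw [tHat_eq hs hu]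
  by_contra! hlt
  have h1 := strictAntiOn_laplaceTail_pow hl (gHat_nonneg hK0 hb (x := x) (d := d))
    (hK.integrable_gHat hb).integrableOn (setIntegral_gHat_pos hK hK0 hb i hi)
    (c := 2 ^ (d + 1)) (κ := n / 2) (by positivity) (by positivity) hd hs.1 ht hlt
  simp only [← shellBound_eq_laplaceTail] at h1
  rw [hs.2] at h1
  linarith

/-- On (l, β] the weight e^(-sv) / v is at least its value at β, so only the mass of ĝ there
matters. -/
theorem le_shellBound (hK : IsSmoothingKernel K) (hK0 : ∀ u, 0 ≤ K u) (hb : 0 < b) (hl : 0 < l)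
    {β m : ℝ} (hβ : 0 < β) (hm : m ≤ ∫ v in Ioc l β, gHat d K b x v) {t : ℝ} (ht : 0 < t) :
    2 ^ (d + 1) / t ^ d * (m / β * Real.exp (-(n * t ^ d / 2 * β))) ≤ shellBound d K b l x t := by
  rw [shellBound_eq_laplaceTail]
  have hg0 := gHat_nonneg hK0 hb (x := x) (d := d)
  have hs : (0 : ℝ) ≤ n / 2 * t ^ d := by positivity
  have hi := integrableOn_laplaceTail hl (hK.integrable_gHat hb (x := x) (d := d)).integrableOn hs
  gcongr
  calc m / β * Real.exp (-(n * t ^ d / 2 * β))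
      ≤ (∫ v in Ioc l β, gHat d K b x v) * (1 / β * Real.exp (-(n * t ^ d / 2 * β))) := by
        rw [div_eq_mul_one_div, mul_assoc]
        gcongr
    _ = ∫ v in Ioc l β, gHat d K b x v * (1 / β * Real.exp (-(n * t ^ d / 2 * β))) := by
        rw [integral_mul_const]
    _ ≤ ∫ v in Ioc l β, gHat d K b x v / v * Real.exp (-(n / 2 * t ^ d * v)) := by
        refine setIntegral_mono_on ((hK.integrable_gHat hb).integrableOn.mul_const _)
          (hi.mono_set Ioc_subset_Ioi_self) measurableSet_Ioc fun v hv => ?_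
        have hv0 : 0 < v := hl.trans hv.1
        have := hg0 v
        rw [div_eq_mul_one_div (gHat d K b x v) v, mul_assoc]
        gcongr
        · exact hv.2
        · exact le_of_eq (by ring)
        · exact hv.2
    _ ≤ laplaceTail (gHat d K b x) l (n / 2 * t ^ d) := by
        refine setIntegral_mono_set hi ?_ Ioc_subset_Ioi_self.eventuallyLE
        filter_upwards [ae_restrict_mem measurableSet_Ioi] with v hv
        have hv0 : 0 < v := hl.trans hv
        have := hg0 v
        positivity

end

/-! ### Covering bound for the Hausdorff distance -/

/-- A maximal separated subset covers, and a lower bound on the mass of balls bounds its size. -/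
theorem exists_finset_cover_card_mul_le {X : Type*} [PseudoMetricSpace X] [MeasurableSpace X]
    [OpensMeasurableSpace X] (P : Measure X) [IsProbabilityMeasure P] {M : Set X} {r c : ℝ}
    (hc : 0 < c) (hball : ∀ y ∈ M, c ≤ P.real (Metric.closedBall y (r / 2))) :
    ∃ F : Finset X, (∀ y ∈ F, y ∈ M) ∧ (∀ x ∈ M, ∃ y ∈ F, dist x y ≤ r) ∧ F.card * c ≤ 1 := by
  classical
  set Sep : Finset X → Prop := fun F =>
    (∀ y ∈ F, y ∈ M) ∧ ∀ y ∈ F, ∀ z ∈ F, y ≠ z → r < dist y z with hSep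
  have hcard : ∀ F, Sep F → F.card * c ≤ 1 := by
    rintro F ⟨hFM, hF⟩
    have hdisj : (F : Set X).PairwiseDisjoint fun y => Metric.closedBall y (r / 2) := by
      intro y hy z hz hyz
      exact Metric.closedBall_disjoint_closedBall (by linarith [hF y hy z hz hyz])
    calc (F.card : ℝ) * c = ∑ _y ∈ F, c := by rw [Finset.sum_const, nsmul_eq_mul]
      _ ≤ ∑ y ∈ F, P.real (Metric.closedBall y (r / 2)) :=
          Finset.sum_le_sum fun y hy => hball y (hFM y hy)
      _ = P.real (⋃ y ∈ F, Metric.closedBall y (r / 2)) :=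
          (measureReal_biUnion_finset hdisj fun y _ => Metric.isClosed_closedBall.measurableSet).symm
      _ ≤ 1 := measureReal_le_one
  have hbdd : BddAbove {k | ∃ F, Sep F ∧ F.card = k} := by
    refine ⟨⌊1 / c⌋₊, ?_⟩
    rintro _ ⟨F, hF, rfl⟩
    refine Nat.le_floor ?_
    rw [le_div_iff₀ hc]; exact hcard F hF
  obtain ⟨F, hF, hFc⟩ := Nat.sSup_mem (s := {k | ∃ F, Sep F ∧ F.card = k})
    ⟨0, ∅, by simp [hSep], rfl⟩ hbdd
  refine ⟨F, hF.1, fun x hx => ?_, hcard F hF⟩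
  by_contra! hfar
  -- No sign of r is assumed: x ∈ F would force r < 0, and then the balls are empty, against the
  -- lower mass bound c > 0.
  have hxF : x ∉ F := fun h => by
    have h1 := hfar x h
    have h2 := hball x hx
    rw [dist_self] at h1
    rw [Metric.closedBall_eq_empty.2 (by linarith), measureReal_empty] at h2
    linarith
  have hins : Sep (insert x F) := by
    refine ⟨fun y hy => ?_, fun y hy z hz hyz => ?_⟩
    · rcases Finset.mem_insert.1 hy with rfl | hy
      exacts [hx, hF.1 y hy]
    · rcases Finset.mem_insert.1 hy with rfl | hy' <;>
        rcases Finset.mem_insert.1 hz with rfl | hz'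
      · exact absurd rfl hyz
      · exact hfar z hz'
      · rw [dist_comm]; exact hfar y hy'
      · exact hF.2 y hy' z hz' hyz
  have := le_csSup hbdd ⟨insert x F, hins, rfl⟩
  rw [Finset.card_insert_of_notMem hxF, hFc] at this
  omega

theorem pi_real_forall_notMem_le {Ω : Type*} [MeasurableSpace Ω] (P : Measure Ω)
    [IsProbabilityMeasure P] {S : Set Ω} (hS : MeasurableSet S) {p : ℝ} (hp : p ≤ P.real S)
    (n : ℕ) : (Measure.pi fun _ : Fin n => P).real {x | ∀ j, x j ∉ S} ≤ Real.exp (-(n * p)) := by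
  have e : {x : Fin n → Ω | ∀ j, x j ∉ S} = univ.pi fun _ => Sᶜ := by
    ext x; simp [Set.mem_pi]
  rw [e, measureReal_def, Measure.pi_pi, Finset.prod_const, Finset.card_univ, Fintype.card_fin,
    ENNReal.toReal_pow, ← measureReal_def, probReal_compl_eq_one_sub hS]
  calc (1 - P.real S) ^ n ≤ Real.exp (-p) ^ n := by
        refine pow_le_pow_left₀ (sub_nonneg.2 measureReal_le_one) ?_ n
        have := Real.add_one_le_exp (-p)
        linarith
    _ = Real.exp (-(n * p)) := by rw [← Real.exp_nat_mul]; congr 1; ring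

/-- The covering bound for the Hausdorff distance between the sample and its support. -/
theorem UniformDensity.real_lt_hausdorffDist_le {D d : ℕ} {M : Set (Ambient D)}
    {P : Measure (Ambient D)} [IsProbabilityMeasure P] {ρ t₁ C R : ℝ}
    (h : UniformDensity d M P ρ t₁ C R) (hPM : P Mᶜ = 0) {n : ℕ} {t : ℝ}
    (ht : t ∈ Ioc 0 t₁) :
    (sampleLaw P n).real {x | t < Metric.hausdorffDist (range x) M} ≤
      2 ^ d / (3 / 4 * ρ * t ^ d) * Real.exp (-(n * (3 / 4 * ρ * t ^ d))) := by
  have ht0 : 0 < t := ht.1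
  have hρ := h.rho_pos
  -- A t/2-net has at most 1/c points, from disjoint balls of radius t/4. If every ball of radius
  -- t/2 about the net contains a sample point, each point of `M` is within t/2 + t/2 of the sample.
  set c := 3 / 4 * ρ * (t / 2) ^ d with hc
  have hc0 : 0 < c := by positivity
  obtain ⟨F, hFM, hFc, hFcard⟩ := exists_finset_cover_card_mul_le P (M := M) (r := t / 2) hc0
    fun y hy => h.le_measureReal_ball hy ⟨by positivity, by linarith [ht.2]⟩
  have hM : ∀ᵐ y ∂P, y ∈ M := by rw [ae_iff]; exact hPM
  have hMall : ∀ᵐ x ∂(sampleLaw P n), ∀ i, x i ∈ M := by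
    rw [ae_all_iff]
    exact fun i => (Measure.quasiMeasurePreserving_eval (fun _ => P) i).ae hM
  have hincl : {x : Fin n → Ambient D | t < Metric.hausdorffDist (range x) M} ≤ᵐ[sampleLaw P n]
      ⋃ y ∈ F, {x | ∀ j, x j ∉ Metric.closedBall y (t / 2)} := by
    filter_upwards [hMall] with x hxM hx
    by_contra hnot
    refine (not_le.2 (show t < Metric.hausdorffDist (range x) M from hx)) ?_
    refine Metric.hausdorffDist_le_of_mem_dist ht0.le ?_ fun z hz => ?_
    · rintro _ ⟨i, rfl⟩
      exact ⟨x i, hxM i, by rw [dist_self]; exact ht0.le⟩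
    · obtain ⟨y, hy, hzy⟩ := hFc z hz
      have h1 : ¬ ∀ j, x j ∉ Metric.closedBall y (t / 2) := fun h2 =>
        hnot (mem_iUnion₂.2 ⟨y, hy, h2⟩)
      push Not at h1
      obtain ⟨j, hj⟩ := h1
      refine ⟨x j, mem_range_self j, ?_⟩
      have h3 := dist_triangle_right z (x j) y
      have h4 : dist (x j) y ≤ t / 2 := hj
      linarith
  calc (sampleLaw P n).real {x | t < Metric.hausdorffDist (range x) M}
      ≤ (sampleLaw P n).real (⋃ y ∈ F, {x | ∀ j, x j ∉ Metric.closedBall y (t / 2)}) :=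
        ENNReal.toReal_mono (measure_ne_top _ _) (measure_mono_ae hincl)
    _ ≤ ∑ y ∈ F, (sampleLaw P n).real {x | ∀ j, x j ∉ Metric.closedBall y (t / 2)} :=
        measureReal_biUnion_finset_le _ _
    _ ≤ ∑ y ∈ F, Real.exp (-(n * (3 / 4 * ρ * t ^ d))) := Finset.sum_le_sum fun y hy =>
        pi_real_forall_notMem_le P Metric.isClosed_closedBall.measurableSet
          (h.le_measureReal_ball (hFM y hy) ht) n
    _ ≤ _ := by
        rw [Finset.sum_const, nsmul_eq_mul]
        gcongr
        rw [le_div_iff₀ (by positivity)]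
        calc (F.card : ℝ) * (3 / 4 * ρ * t ^ d) = F.card * c * 2 ^ d := by
              rw [hc, div_pow]; field_simp
          _ ≤ 1 * 2 ^ d := by gcongr
          _ = 2 ^ d := one_mul _

/-! ### The threshold radius -/

noncomputable section

/-- A deterministic radius which separates, for large samples, the Hausdorff distance between the
sample and the support from the solution of the shells equation. -/
def thresholdRadius (d : ℕ) (ρ : ℝ) (n : ℕ) : ℝ :=
  (4 / (3 * ρ) * (Real.log n / n)) ^ (1 / (d : ℝ))

end

theorem thresholdRadius_pow {d : ℕ} (hd : 0 < d) {ρ : ℝ} (hρ : 0 < ρ) (n : ℕ) :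
    thresholdRadius d ρ n ^ d = 4 / (3 * ρ) * (Real.log n / n) := by
  have := Real.log_natCast_nonneg n
  rw [thresholdRadius, ← Real.rpow_natCast, ← Real.rpow_mul (by positivity),
    one_div_mul_cancel (by positivity), Real.rpow_one]

theorem thresholdRadius_pos {d : ℕ} {ρ : ℝ} (hρ : 0 < ρ) {n : ℕ} (hn : 2 ≤ n) :
    0 < thresholdRadius d ρ n := by
  have h1 : (1 : ℝ) < n := by exact_mod_cast hn
  have := Real.log_pos h1
  exact Real.rpow_pos_of_pos (by positivity) _

theorem tendsto_thresholdRadius {d : ℕ} (hd : 0 < d) (ρ : ℝ) :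
    Tendsto (thresholdRadius d ρ) atTop (𝓝 0) := by
  have h1 : Tendsto (fun n : ℕ => Real.log n / n) atTop (𝓝 0) :=
    (Real.isLittleO_log_id_atTop.tendsto_div_nhds_zero).comp tendsto_natCast_atTop_atTop
  have h2 := (h1.const_mul (4 / (3 * ρ))).rpow_const (p := 1 / (d : ℝ)) (Or.inr (by positivity))
  rwa [mul_zero, Real.zero_rpow (by positivity)] at h2

theorem tendsto_log_natCast : Tendsto (fun n : ℕ => Real.log n) atTop atTop :=
  Real.tendsto_log_atTop.comp tendsto_natCast_atTop_atTop

/-- At the threshold each ball has mass at least log n / n, hence is missed with probability at most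
1/n, and there are at most 2^d n / log n balls: the bound is 2^d / log n. -/
theorem UniformDensity.tendsto_real_lt_hausdorffDist {D d : ℕ} (hd : 0 < d) {M : Set (Ambient D)}
    {P : Measure (Ambient D)} [IsProbabilityMeasure P] {ρ t₁ C R : ℝ}
    (h : UniformDensity d M P ρ t₁ C R) (hPM : P Mᶜ = 0) :
    Tendsto (fun n => (sampleLaw P n).real
      {x | thresholdRadius d ρ n < Metric.hausdorffDist (range x) M}) atTop (𝓝 0) := by
  have hρ := h.rho_pos
  refine squeeze_zero' (Eventually.of_forall fun n => measureReal_nonneg) ?_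
    (tendsto_log_natCast.const_div_atTop (2 ^ d))
  filter_upwards [eventually_ge_atTop 2,
    (tendsto_thresholdRadius hd ρ).eventually_le_const h.scale_pos] with n hn hnt
  refine (h.real_lt_hausdorffDist_le hPM ⟨thresholdRadius_pos hρ hn, hnt⟩).trans
    (le_of_eq ?_)
  have hn0 : (0 : ℝ) < n := by positivity
  have hlog : 0 < Real.log n := Real.log_pos (by exact_mod_cast hn)
  have e : 3 / 4 * ρ * thresholdRadius d ρ n ^ d = Real.log n / n := by
    rw [thresholdRadius_pow hd hρ]; field_simp
  rw [e, mul_div_cancel₀ _ hn0.ne', Real.exp_neg, Real.exp_log hn0]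
  field_simp

/-! ### Random splitting of the sample -/

section splitting

variable {D : ℕ}

theorem measurePreserving_pi_comp_injective {Ω ι : Type*} [MeasurableSpace Ω] [Fintype ι]
    (P : Measure Ω) [IsProbabilityMeasure P] {n : ℕ} {e : Fin n → ι} (he : Function.Injective e) :
    MeasurePreserving (fun (x : ι → Ω) i => x (e i)) (Measure.pi fun _ => P)
      (Measure.pi fun _ => P) := by
  have hm : Measurable fun (x : ι → Ω) i => x (e i) :=
    measurable_pi_iff.2 fun i => measurable_pi_apply _
  refine ⟨hm, ?_⟩
  have h1 := ProbabilityTheory.iIndepFun_pi (μ := fun _ : ι => P) (X := fun _ ω => ω)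
    fun _ => aemeasurable_id
  have h2 := (ProbabilityTheory.iIndepFun_iff_map_fun_eq_pi_map
    fun i => (measurable_pi_apply (e i)).aemeasurable).1 (h1.precomp he)
  rw [h2]
  congr 1
  ext1 i
  exact (measurePreserving_eval (fun _ : ι => P) (e i)).map_eq

instance discreteMeasurableSpace_perm (n : ℕ) :
    DiscreteMeasurableSpace (Equiv.Perm (Fin n ⊕ Fin n)) :=
  ⟨fun _ => trivial⟩

/-- Selecting `n` coordinates after a random permutation gives an i.i.d. sample of size `n`. -/
theorem splitLaw_real_preimage_le (P : Measure (Ambient D)) [IsProbabilityMeasure P] {n : ℕ}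
    {e : Fin n → Fin n ⊕ Fin n} (he : Function.Injective e) (S : Set (Fin n → Ambient D)) :
    (splitLaw P n).real {ω | (fun i => ω.1 (ω.2 (e i))) ∈ S} ≤ (sampleLaw P n).real S := by
  have hm : Measurable fun (ω : (Fin n ⊕ Fin n → Ambient D) × Equiv.Perm (Fin n ⊕ Fin n))
      (i : Fin n) => ω.1 (ω.2 (e i)) :=
    measurable_from_prod_countable_left fun σ => measurable_pi_iff.2 fun i =>
      measurable_pi_apply (σ (e i))
  refine ENNReal.toReal_mono (measure_ne_top _ _) ?_
  -- `S` need not be measurable, so the argument runs on its measurable hull; for each fixed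
  -- permutation the selection is an injective choice of i.i.d. coordinates.
  set S' := toMeasurable (sampleLaw P n) S with hS'
  have hS'm : MeasurableSet S' := measurableSet_toMeasurable _ _
  calc (splitLaw P n) {ω | (fun i => ω.1 (ω.2 (e i))) ∈ S}
      ≤ (splitLaw P n) ((fun ω i => ω.1 (ω.2 (e i))) ⁻¹' S') :=
        measure_mono fun ω hω => subset_toMeasurable _ _ hω
    _ = ∫⁻ _σ, sampleLaw P n S' ∂(PMF.uniformOfFintype (Equiv.Perm (Fin n ⊕ Fin n))).toMeasure := by
        rw [splitLaw, Measure.prod_apply_symm (hm hS'm)]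
        refine lintegral_congr fun σ => ?_
        exact (measurePreserving_pi_comp_injective P (σ.injective.comp he)).measure_preimage
          hS'm.nullMeasurableSet
    _ = sampleLaw P n S := by rw [lintegral_const, measure_univ, mul_one, measure_toMeasurable]

end splitting

/-! ### Lower bound for the radius, and coverage -/

section

variable {D d : ℕ} {M : Set (Ambient D)} {P : Measure (Ambient D)} {ρ t₁ C R : ℝ}

/-- Values of the local density slightly above its infimum have positive probability. -/
theorem UniformDensity.exists_measureReal_Icc_pos [IsProbabilityMeasure P]
    (h : UniformDensity d M P ρ t₁ C R) (hM : MeasurableSet M) (hPM : P Mᶜ = 0) {g : ℝ → ℝ}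
    (hg : IsShellDensity d P g) {ε : ℝ} (hε : 0 < ε) :
    ∃ η > 0, 0 < P.real (M ∩ localDensity d P ⁻¹' Icc (ρ + η) (ρ + ε)) := by
  by_contra! hcon
  have hU := h.measureReal_lt_pos hPM hε
  have hq := h.aemeasurable_localDensity hM hPM
  -- The existence of a density rules out an atom at ρ. The resulting margin η keeps enough V_i
  -- above the endpoint l = ρ despite the estimation error.
  have h0 : P (localDensity d P ⁻¹' {ρ}) = 0 := by
    rw [hg.measure_preimage_eq hq (measurableSet_singleton ρ)]; simp
  have hA : ∀ k : ℕ, P (M ∩ localDensity d P ⁻¹' Icc (ρ + 1 / (k + 1)) (ρ + ε)) = 0 := fun k => by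
    have := le_antisymm (hcon (1 / ((k : ℝ) + 1)) (by positivity)) measureReal_nonneg
    rwa [measureReal_eq_zero_iff] at this
  refine hU.ne' ?_
  rw [measureReal_eq_zero_iff]
  refine measure_mono_null ?_ (measure_union_null h0 (measure_iUnion_null hA))
  rintro x ⟨hxM, hx⟩
  rcases (h.lower_le x hxM).eq_or_lt with he | hlt
  · exact Or.inl he.symm
  · right
    obtain ⟨k, hk⟩ := exists_nat_one_div_lt (sub_pos.2 hlt)
    exact mem_iUnion.2 ⟨k, hxM, by linarith, hx.le⟩

/-- Bernstein's inequality with l = p/4 and the crude variance bound 1; it ensures a positive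
fraction of sample points in A. -/
theorem pi_real_card_lt_le {Ω : Type*} [MeasurableSpace Ω] (P : Measure Ω)
    [IsProbabilityMeasure P] {A : Set Ω} (hA : MeasurableSet A) (n : ℕ) :
    (Measure.pi fun _ : Fin n => P).real
      {x | ∑ j, A.indicator (fun _ => (1 : ℝ)) (x j) < n * (P.real A / 2)} ≤
      2 * Real.exp (-(n * (P.real A ^ 2 / 16))) := by
  set p := P.real A with hp
  have hp0 : 0 ≤ p := measureReal_nonneg
  have hp1 : p ≤ 1 := measureReal_le_one
  have hint : ∫ ω, A.indicator (fun _ => (1 : ℝ)) ω ∂P = p := by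
    rw [integral_indicator_const _ hA]; simp [hp]
  have hint2 : ∫ ω, A.indicator (fun _ => (1 : ℝ)) ω ^ 2 ∂P ≤ 1 := by
    have : ∀ ω, A.indicator (fun _ => (1 : ℝ)) ω ^ 2 = A.indicator (fun _ => (1 : ℝ)) ω := by
      intro ω; by_cases hω : ω ∈ A <;> simp [hω]
    simp_rw [this]
    rw [hint]; exact hp1
  have key := pi_real_le_abs_sum_sub_le_exp P (f := A.indicator fun _ => (1 : ℝ))
    (measurable_const.indicator hA).aestronglyMeasurable (B := 1) (l := p / 4)
    (fun ω => by by_cases hω : ω ∈ A <;> simp [hω]) hint2 n (by positivity) (by linarith)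
    (n * (p / 2))
  rw [hint] at key
  have e : (n : ℝ) * ((p / 4) ^ 2 * 1) - p / 4 * (n * (p / 2)) = -(n * (p ^ 2 / 16)) := by ring
  rw [e] at key
  refine (measureReal_mono (fun x hx => ?_) (measure_ne_top _ _)).trans key
  have hx : ∑ j, A.indicator (fun _ => (1 : ℝ)) (x j) < n * (p / 2) := hx
  have := neg_abs_le (∑ j, A.indicator (fun _ => (1 : ℝ)) (x j) - n * p)
  change n * (p / 2) ≤ _
  linarith

theorem IsSmoothingKernel.eventually_le_setIntegral {K : ℝ → ℝ} (hK : IsSmoothingKernel K)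
    {b : ℕ → ℝ} (hb : ∀ n, 0 < b n) (hb0 : Tendsto b atTop (𝓝 0)) {ζ : ℝ} (hζ : 0 < ζ) :
    ∀ᶠ n in atTop, 1 / 4 ≤ ∫ u in Ioc 0 (ζ / b n), K u := by
  have ht : Tendsto (fun R => ∫ u in (0 : ℝ)..R, K u) atTop (𝓝 (∫ u in Ioi 0, K u)) :=
    intervalIntegral_tendsto_integral_Ioi 0 hK.integrable.integrableOn tendsto_id
  rw [hK.setIntegral_Ioi_zero] at ht
  have hbi : Tendsto (fun n => ζ / b n) atTop atTop := by
    have h1 : Tendsto b atTop (𝓝[>] 0) :=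
      tendsto_nhdsWithin_iff.2 ⟨hb0, Eventually.of_forall hb⟩
    exact h1.inv_tendsto_nhdsGT_zero.const_mul_atTop hζ
  filter_upwards [(ht.comp hbi).eventually_const_le (show (1 : ℝ) / 4 < 1 / 2 by norm_num)] with n hn
  rwa [Function.comp_apply, intervalIntegral.integral_of_le (div_nonneg hζ.le (hb n).le)] at hn

/-- At the threshold radius the lower bound for the shells bound diverges. -/
theorem tendsto_shell_lower_bound (hd : 0 < d) (hρ : 0 < ρ) {m : ℝ} (hm : 0 < m) :
    Tendsto (fun n : ℕ => 2 ^ (d + 1) / thresholdRadius d ρ n ^ d *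
      (m / (5 / 4 * ρ) * Real.exp (-(n * thresholdRadius d ρ n ^ d / 2 * (5 / 4 * ρ)))))
      atTop atTop := by
  -- At the threshold the exponent is (4/3)(5/4)(1/2) log n = (5/6) log n, so the expression equals
  -- 72 c n^(1/6) / log n. By e^y ≥ y²/2 with y = (log n)/6 it is at least c log n; hence 72 = 2 ·
  -- 36.
  set c := 2 ^ (d + 1) * (3 * ρ / 4) * (m / (5 / 4 * ρ)) / 72 with hc
  have hc0 : 0 < c := by positivity
  refine tendsto_atTop_mono' _ ?_ (tendsto_log_natCast.const_mul_atTop hc0)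
  filter_upwards [eventually_ge_atTop 2] with n hn
  have hn0 : (0 : ℝ) < n := by positivity
  set L := Real.log n with hL
  have hL0 : 0 < L := Real.log_pos (by exact_mod_cast hn)
  have hexp : (n : ℝ) = Real.exp L := (Real.exp_log hn0).symm
  have e1 : n * thresholdRadius d ρ n ^ d / 2 * (5 / 4 * ρ) = 5 / 6 * L := by
    rw [thresholdRadius_pow hd hρ, ← hL]; field_simp; ring
  have e2 : (n : ℝ) * Real.exp (-(5 / 6 * L)) = Real.exp (L / 6) := by
    rw [hexp, ← Real.exp_add]; congr 1; ring
  rw [e1, thresholdRadius_pow hd hρ]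
  have e3 : 2 ^ (d + 1) / (4 / (3 * ρ) * (L / n)) * (m / (5 / 4 * ρ) * Real.exp (-(5 / 6 * L))) =
      c * 72 * Real.exp (L / 6) / L := by
    rw [← e2, hc]; field_simp
  rw [e3, le_div_iff₀ hL0]
  have h1 := Real.quadratic_le_exp_of_nonneg (show 0 ≤ L / 6 by positivity)
  calc c * L * L = c * 72 * ((L / 6) ^ 2 / 2) := by ring
    _ ≤ c * 72 * Real.exp (L / 6) := by gcongr; nlinarith

/-- With probability tending to one, the solution of the shells equation exceeds the threshold
radius, for every lower endpoint `l` which is at most `ρ` or at most all shell values. -/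
theorem UniformDensity.exists_bad_event [IsProbabilityMeasure P] (hd : 0 < d)
    (h : UniformDensity d M P ρ t₁ C R) (hM : IsClosed M) (hPM : P Mᶜ = 0) {g : ℝ → ℝ}
    (hg : IsShellDensity d P g) {K : ℝ → ℝ} (hK : IsSmoothingKernel K) (hK0 : ∀ u, 0 ≤ K u)
    {α : ℝ} (hα : 0 < α) {b : ℕ → ℝ} (hb : ∀ n, 0 < b n) (hb0 : Tendsto b atTop (𝓝 0)) :
    ∃ Bad : ∀ n, Set (Fin n → Ambient D),
      Tendsto (fun n => (sampleLaw P n).real (Bad n)) atTop (𝓝 0) ∧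
      ∀ᶠ n in atTop, ∀ x ∉ Bad n, ∀ l, 0 < l → (l ≤ ρ ∨ ∀ i, l ≤ shellValue d x i) →
        (∃ i, l ≤ shellValue d x i) ∧ thresholdRadius d ρ n ≤ tHat d K α (b n) l x := by
  classical
  have hρ := h.rho_pos
  -- With errors at most min(η, ρ/16), points with q in [ρ + η, 9ρ/8] have ρ ≤ V_i ≤ 19ρ/16 = 5ρ/4 -
  -- ρ/16, which leaves a window ρ/16 for the right half of the kernel.
  obtain ⟨η, hη, hp⟩ := h.exists_measureReal_Icc_pos hM.measurableSet hPM hg (ε := ρ / 8)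
    (by positivity)
  set A := M ∩ localDensity d P ⁻¹' Icc (ρ + η) (ρ + ρ / 8) with hA
  have hAm : MeasurableSet A :=
    (h.continuousOn_localDensity.preimage_isClosed_of_isClosed hM isClosed_Icc).measurableSet
  set p := P.real A with hpdef
  set C₃ := C + 2 * R + 4 with hC₃
  refine ⟨fun n => {x | ¬ ∀ i, |shellValue d x i - localDensity d P (x i)| ≤ C₃ * rate d n} ∪
    {x | ∑ j, A.indicator (fun _ => (1 : ℝ)) (x j) < n * (p / 2)}, ?_, ?_⟩
  · have hlim1 : Tendsto (fun n : ℕ => 2 / (n : ℝ) ^ 2) atTop (𝓝 0) :=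
      ((tendsto_pow_atTop (by norm_num)).comp tendsto_natCast_atTop_atTop).const_div_atTop 2
    have hlim2 : Tendsto (fun n : ℕ => 2 * Real.exp (-(n * (p ^ 2 / 16)))) atTop (𝓝 0) := by
      have h1 : Tendsto (fun n : ℕ => (n : ℝ) * (p ^ 2 / 16)) atTop atTop :=
        tendsto_natCast_atTop_atTop.atTop_mul_const (by positivity)
      simpa using (Real.tendsto_exp_neg_atTop_nhds_zero.comp h1).const_mul 2
    have hlim := hlim1.add hlim2
    rw [add_zero] at hlim
    refine squeeze_zero' (Eventually.of_forall fun n => measureReal_nonneg) ?_ hlim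
    filter_upwards [eventually_ge_atTop 3, (tendsto_rate d).eventually_le_const h.scale_pos,
      (tendsto_rate d).eventually_le_const (show (0 : ℝ) < 1 / 2 by norm_num)] with n hn hr hr2
    exact (measureReal_union_le _ _).trans
      (add_le_add (h.real_shellValue_sub_le hPM hn hr hr2) (pi_real_card_lt_le P hAm n))
  · have hrC : Tendsto (fun n => C₃ * rate d n) atTop (𝓝 0) := by
      simpa using (tendsto_rate d).const_mul C₃
    filter_upwards [eventually_ge_atTop 2, hrC.eventually_le_const hη,
      hrC.eventually_le_const (show 0 < ρ / 16 by positivity),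
      hK.eventually_le_setIntegral hb hb0 (show 0 < ρ / 16 by positivity),
      (tendsto_shell_lower_bound hd hρ (show 0 < p / 2 * (1 / 4) by positivity)).eventually_ge_atTop
        α] with n hn hr1 hr2 hKn hαn x hx l hl hlx
    simp only [mem_union, mem_ofPred_eq, not_or, not_not, not_lt] at hx
    obtain ⟨hV, hcount⟩ := hx
    have hn0 : (0 : ℝ) < n := by positivity
    set I := Finset.univ.filter fun i => x i ∈ A with hI
    have hIcard : n * (p / 2) ≤ (I.card : ℝ) := by
      refine hcount.trans (le_of_eq ?_)
      rw [hI, Finset.card_filter, Nat.cast_sum]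
      refine Finset.sum_congr rfl fun j _ => ?_
      by_cases hj : x j ∈ A <;> simp [hj]
    have hIne : I.Nonempty := by
      rw [← Finset.card_pos]
      have : (0 : ℝ) < I.card := lt_of_lt_of_le (by positivity) hIcard
      exact_mod_cast this
    have hIV : ∀ i ∈ I, l ≤ shellValue d x i ∧ shellValue d x i ≤ 5 / 4 * ρ - ρ / 16 := by
      intro i hi
      have hiA : x i ∈ A := (Finset.mem_filter.1 hi).2
      obtain ⟨h1, h2⟩ := hiA.2
      obtain ⟨h3, h4⟩ := abs_le.1 (hV i)
      refine ⟨?_, by linarith⟩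
      rcases hlx with hlρ | hall
      · linarith
      · exact hall i
    obtain ⟨i, hi⟩ := hIne
    refine ⟨⟨i, (hIV i hi).1⟩, ?_⟩
    refine le_tHat_of_le_shellBound hd hK hK0 hα (hb n) hl i (hIV i hi).1
      (thresholdRadius_pos hρ hn) (hαn.trans ?_)
    refine le_shellBound hK hK0 (hb n) hl (by positivity) ?_ (thresholdRadius_pos hρ hn)
    refine le_trans ?_ (le_setIntegral_gHat hK hK0 (hb n) (by positivity) I hIV)
    exact mul_le_mul (by rw [le_div_iff₀ hn0]; linarith) hKn (by norm_num) (by positivity)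

theorem shellValue_pos {n : ℕ} (hn : 2 ≤ n) (x : Fin n → Ambient D) (i : Fin n) :
    0 < shellValue d x i := by
  have hr : 0 < rate d n := rate_pos hn
  have hcard : 0 < Nat.card {j : Fin n // x j ∈ Metric.closedBall (x i) (rate d n / 2)} := by
    have : Nonempty {j : Fin n // x j ∈ Metric.closedBall (x i) (rate d n / 2)} :=
      ⟨⟨i, Metric.mem_closedBall_self (by positivity)⟩⟩
    exact Nat.card_pos
  unfold shellValue rhoHat
  positivity

theorem rhoHatMin_le {n : ℕ} (x : Fin n → Ambient D) (i : Fin n) :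
    rhoHatMin d x ≤ shellValue d x i :=
  ciInf_le (finite_range _).bddBelow i

theorem exists_shellValue_eq_rhoHatMin {n : ℕ} (hn : 2 ≤ n) (x : Fin n → Ambient D) :
    ∃ i, shellValue d x i = rhoHatMin d x := by
  have : Nonempty (Fin n) := ⟨⟨0, by omega⟩⟩
  exact exists_eq_ciInf_of_finite

theorem rhoHatMin_pos {n : ℕ} (hn : 2 ≤ n) (x : Fin n → Ambient D) : 0 < rhoHatMin d x := by
  obtain ⟨i, hi⟩ := exists_shellValue_eq_rhoHatMin (d := d) hn x
  rw [← hi]; exact shellValue_pos hn x i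

/-- Coverage of a data-splitting radius which exceeds a deterministic threshold outside an
asymptotically negligible event. -/
theorem exists_splitLaw_real_le [IsProbabilityMeasure P] {α : ℝ} (hα : 0 < α) {t : ℕ → ℝ}
    (ht : Tendsto (fun n => (sampleLaw P n).real
      {x | t n < Metric.hausdorffDist (range x) M}) atTop (𝓝 0))
    {Bad : ∀ n, Set (Fin n → Ambient D)}
    (hBad : Tendsto (fun n => (sampleLaw P n).real (Bad n)) atTop (𝓝 0))
    {T : ∀ n, (Fin n → Ambient D) → ℝ} (hT : ∀ᶠ n in atTop, ∀ x ∉ Bad n, t n ≤ T n x) :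
    ∃ C : ℝ, ∃ N : ℕ, ∀ n ≥ N,
      (splitLaw P n).real {ω | Metric.hausdorffDist (range (secondHalf ω)) M >
        T n (firstHalf ω)} ≤ α + C * rate d n := by
  -- The failure probability tends to 0 and α > 0, so the constant 0 works. A union bound over the
  -- two halves suffices, without their independence.
  refine ⟨0, eventually_atTop.1 ?_⟩
  have hsum := ht.add hBad
  rw [add_zero] at hsum
  filter_upwards [hsum.eventually_le_const hα, hT] with n hn hTn
  have hprob : IsProbabilityMeasure (splitLaw P n) := by unfold splitLaw; infer_instance
  rw [zero_mul, add_zero]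
  refine le_trans ?_ hn
  have hsub : {ω | Metric.hausdorffDist (range (secondHalf ω)) M > T n (firstHalf ω)} ⊆
      {ω : (Fin n ⊕ Fin n → Ambient D) × Equiv.Perm (Fin n ⊕ Fin n) |
        secondHalf ω ∈ {x | t n < Metric.hausdorffDist (range x) M}} ∪
      {ω | firstHalf ω ∈ Bad n} := by
    intro ω hω
    by_cases hB : firstHalf ω ∈ Bad n
    · exact Or.inr hB
    · exact Or.inl ((hTn _ hB).trans_lt hω)
  exact (measureReal_mono hsub (measure_ne_top _ _)).trans ((measureReal_union_le _ _).trans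
    (add_le_add (splitLaw_real_preimage_le P Sum.inr_injective _)
      (splitLaw_real_preimage_le P Sum.inl_injective _)))

end

/-! ### Consistency of the estimator and coverage of the radius -/

theorem mainTheorem4 (D d : ℕ) (hd : 0 < d) (M : Set (Ambient D)) (P : Measure (Ambient D))
    (hM : ManifoldModel d M P) (hP : RegularDensity d M P)
    (g : ℝ → ℝ) (hg : IsShellDensity d P g)
    (K : ℝ → ℝ) (hK : IsSmoothingKernel K) :
    -- (1) uniform consistency of the kernel estimator
    (Differentiable ℝ g → (∃ L : ℝ≥0, LipschitzWith L (deriv g)) →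
      (∃ C C' : ℝ, ∀ ε > (0 : ℝ), ∃ A : ℝ, ∃ N : ℕ, ∀ n ≥ N, ∀ b > (0 : ℝ),
        (sampleLaw P n).real {x | ¬ ∀ v : ℝ, |gHat d K b x v - g v| ≤
          C * b ^ 2 + A * √(Real.log n / (n * b)) + C' * (rate d n / b ^ 2)} ≤ ε) ∧
      (∀ b : ℕ → ℝ, (∀ n, 0 < b n) → b =Θ[atTop] (fun n => rate d n ^ (1 / 4 : ℝ)) →
        ∀ ε > (0 : ℝ), ∃ A : ℝ, ∃ N : ℕ, ∀ n ≥ N,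
          (sampleLaw P n).real {x | ¬ ∀ v : ℝ, |gHat d K (b n) x v - g v| ≤
            A * √(rate d n)} ≤ ε)) ∧
    -- (2) coverage of the data-splitting radius
    ((∀ u, 0 ≤ K u) → ∀ α ∈ Ioo (0 : ℝ) 1, ∀ b : ℕ → ℝ, (∀ n, 0 < b n) →
      Tendsto b atTop (𝓝 0) →
      -- lower endpoint of integration: the estimate of the minimal density
      ((∀ n ≥ 2, ∀ x : Fin n → Ambient D, ∃! t, SolvesShell d K α (b n) (rhoHatMin d x) x t) ∧
        ∃ C : ℝ, ∃ N : ℕ, ∀ n ≥ N,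
          (splitLaw P n).real {ω | Metric.hausdorffDist (range (secondHalf ω)) M >
            tHat d K α (b n) (rhoHatMin d (firstHalf ω)) (firstHalf ω)} ≤ α + C * rate d n) ∧
      -- lower endpoint of integration: the minimal density itself
      (Tendsto (fun n => (sampleLaw P n).real
          {x | ¬ ∃! t, SolvesShell d K α (b n) (rhoMin d M P) x t}) atTop (𝓝 0) ∧
        ∃ C : ℝ, ∃ N : ℕ, ∀ n ≥ N,
          (splitLaw P n).real {ω | Metric.hausdorffDist (range (secondHalf ω)) M >
            tHat d K α (b n) (rhoMin d M P) (firstHalf ω)} ≤ α + C * rate d n)) := by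

  have hprob := hM.prob
  have hPM := hM.supported
  have hMc : IsClosed M := hM.compact.isClosed
  have hMne : M.Nonempty := by
    rw [nonempty_iff_ne_empty]
    rintro rfl
    simp at hPM
  obtain ⟨t₁, C, R, h⟩ := hP.uniformDensity hMne
  refine ⟨fun hgd ⟨L, hL⟩ => ?_, fun hK0 α hα b hb hb0 => ?_⟩
  · obtain ⟨C₀, C', A, hC, hC', hA, N, hN⟩ :=
      exists_forall_real_not_abs_gHat_sub_le h hMc.measurableSet hPM hg hK hgd hL
    refine ⟨⟨C₀, C', fun ε hε => ?_⟩, fun b hb hbr ε hε => ?_⟩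
    · obtain ⟨N', hN'⟩ := exists_forall_four_div_sq_le hε
      exact ⟨A, max N N', fun n hn b hb =>
        (hN n (le_of_max_le_left hn) b hb).trans (hN' n (le_of_max_le_right hn))⟩
    · obtain ⟨N', hN'⟩ := exists_forall_four_div_sq_le hε
      obtain ⟨A', N₂, hA'⟩ := exists_error_le_sqrt_rate hC hC' hA hb hbr
      refine ⟨A', max N (max N' N₂), fun n hn => ?_⟩
      have hn1 := le_of_max_le_left hn
      have hn2 := le_of_max_le_left (le_of_max_le_right hn)
      have hn3 := le_of_max_le_right (le_of_max_le_right hn)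
      refine le_trans ?_ ((hN n hn1 (b n) (hb n)).trans (hN' n hn2))
      exact measureReal_mono (fun x hx hv => hx fun v => (hv v).trans (hA' n hn3))
        (measure_ne_top _ _)
  · obtain ⟨Bad, hBad, hgood⟩ := h.exists_bad_event hd hMc hPM hg hK hK0 hα.1 hb hb0
    have hthr := h.tendsto_real_lt_hausdorffDist hd hPM
    refine ⟨⟨fun n hn x => ?_, ?_⟩, ?_, ?_⟩
    · obtain ⟨i, hi⟩ := exists_shellValue_eq_rhoHatMin (d := d) hn x
      exact existsUnique_solvesShell hd hK hK0 hα.1 (hb n) (rhoHatMin_pos hn x) i hi.ge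
    · refine exists_splitLaw_real_le hα.1 hthr hBad
        (T := fun n x => tHat d K α (b n) (rhoHatMin d x) x) ?_
      filter_upwards [hgood, eventually_ge_atTop 2] with n hn hn2 x hx
      exact (hn x hx _ (rhoHatMin_pos hn2 x) (Or.inr (rhoHatMin_le x))).2
    · refine squeeze_zero' (Eventually.of_forall fun n => measureReal_nonneg) ?_ hBad
      filter_upwards [hgood] with n hn
      refine measureReal_mono (fun x hx => ?_) (measure_ne_top _ _)
      by_contra hxB
      obtain ⟨i, hi⟩ := (hn x hxB _ h.rho_pos (Or.inl le_rfl)).1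
      exact hx (existsUnique_solvesShell hd hK hK0 hα.1 (hb n) h.rho_pos i hi)
    · refine exists_splitLaw_real_le hα.1 hthr hBad
        (T := fun n x => tHat d K α (b n) (rhoMin d M P) x) ?_
      filter_upwards [hgood] with n hn x hx
      exact (hn x hx _ h.rho_pos (Or.inl le_rfl)).2
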